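/- Corollary 4.4. Let $d\ge 1$ and let $\Phi$ be a stationary and isotropic Poisson hyperplane process in $\mathbb R^d$ with intensity $\lambda>0$. That is, its hyperplanes are $H(P_i,V_i)$, $i\ge1$, where $H(p,v)=\{x\in\mathbb R^d:\langle x,v\rangle=p\}$ and the points $(P_i,V_i)$ form a Poisson process on $\mathbb R\times S_+^{d-1}$ with intensity measure $\lambda\,dp\otimes\Theta$; here $\Theta$ is the uniform distribution on the upper unit hemisphere $S_+^{d-1}=\{v\in\mathbb R^d:\|v\|=1,\ v_d\ge 0\}$. Let $B_r$ be the closed ball of radius $r>0$ centred at the origin, put $\chi(\emptyset)=0$ and $\chi(K)=1$ for $K\ne\emptyset$, and let $\nu_k$ be $k$-dimensional volume (normalized Hausdorff measure; $\nu_0$ is counting measure). For $k=0,\dots,d-1$ let $$\Psi_k(B_r)=\frac1{(d-k)!}\sum^{*}_{i_1,\dots,i_{d-k}}\chi\Big(\bigcap_{j=1}^{d-k}H(P_{i_j},V_{i_j})\cap B_r\Big),\qquad \zeta_k(B_r)=\frac1{(d-k)!}\sum^{*}_{i_1,\dots,i_{d-k}}\nu_k\Big(\bigcap_{j=1}^{d-k}H(P_{i_j},V_{i_j})\cap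 B_r\Big),$$ with sums over pairwise distinct indices (the number of $k$-flats hitting $B_r$ and their total $k$-volume in $B_r$), and $$Z_{k,r}(\chi)=\frac{(d-k-1)!}{(2\lambda r)^{d-k-1/2}}\big(\Psi_k(B_r)-\mathbb E\Psi_k(B_r)\big),\qquad Z_{k,r}(\nu)=\frac{(d-k-1)!\,r^{-k}}{(2\lambda r)^{d-k-1/2}}\big(\zeta_k(B_r)-\mathbb E\zeta_k(B_r)\big).$$ For $\rho>0$ let $X_1,X_2,\dots$ be i.i.d., where $X_1=(P,V)$ with $P$ uniform on $[-\rho,\rho]$, $V\sim\Theta$, and $P,V$ independent. Put $$g_{\chi,k}(y)=\mathbb E\,\chi\Big(\bigcap_{j=1}^{d-k-1}H(X_j)\cap H(y)\cap B_\rho\Big),\qquad g_{\nu,k}(y)=\rho^{-k}\,\mathbb E\,\nu_k\Big(\bigcap_{j=1}^{d-k-1}H(X_j)\cap H(y)\cap B_\rho\Big),$$ and let $\Sigma(\chi)$ and $\Sigma(\nu)$ be the $d\times d$ matrices, indexed by $k,l=0,\dots,d-1$, with entries $\mathbb E\big(g_{\chi,k}(X_1)g_{\chi,l}(X_1)\big)$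 and $\mathbb E\big(g_{\nu,k}(X_1)g_{\nu,l}(X_1)\big)$, respectively. Write $\sigma_{\nu,k}=\Sigma(\nu)_{k,k}$. Then, for every $\rho>0$: 1. $\Sigma(\chi)$ and $\Sigma(\nu)$ are the asymptotic covariance matrices of $(Z_{k,r}(\chi))_{k=0}^{d-1}$ and $(Z_{k,r}(\nu))_{k=0}^{d-1}$: for all $k,l$, as $r\to\infty$, $\mathbb E\big(Z_{k,r}(\chi)Z_{l,r}(\chi)\big)\to\Sigma(\chi)_{k,l}$ and $\mathbb E\big(Z_{k,r}(\nu)Z_{l,r}(\nu)\big)\to\Sigma(\nu)_{k,l}$ (in particular they do not depend on $\rho$); 2. $\Sigma(\chi)$ has full rank $d$; 3. $\Sigma(\nu)$ has rank $1$; 4. for all $0\le k<l\le d-1$, as $r\to\infty$, $$\frac{Z_{l,r}(\nu)}{\sqrt{\sigma_{\nu,l}}}-\frac{Z_{k,r}(\nu)}{\sqrt{\sigma_{\nu,k}}}\longrightarrow 0\quad\text{in probability.}$$ -/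

import Mathlib

open MeasureTheory ProbabilityTheory Filter Topology
open scoped ENNReal Nat

noncomputable section

namespace PoissonHyperplanes

/-- `d`-dimensional Euclidean space. -/
abbrev E (d : ℕ) : Type := EuclideanSpace ℝ (Fin d)

/-- The unit sphere of `ℝ^d`. -/
abbrev Sph (d : ℕ) : Type := Metric.sphere (0 : E d) 1

/-- Parameters `(p, v)` of hyperplanes: signed distance from the origin and unit normal vector. -/
abbrev Param (d : ℕ) : Type := ℝ × Sph d

/-- The hyperplane `H(p, v) = {x : ⟨x, v⟩ = p}`. -/
def H {d : ℕ} (y : Param d) : Set (E d) := {x | inner ℝ x (y.2 : E d) = y.1}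

/-- The closed ball of radius `r` centred at the origin. -/
def ball (d : ℕ) (r : ℝ) : Set (E d) := Metric.closedBall 0 r

/-- The upper unit hemisphere: unit vectors whose last coordinate is nonnegative. -/
def upperSph (d : ℕ) : Set (Sph d) :=
  {v | ∀ i : Fin d, (i : ℕ) + 1 = d → 0 ≤ (v : E d) i}

/-- The uniform distribution on the upper unit hemisphere: normalized surface measure
(regarded as a measure on the whole sphere which is concentrated on the upper half). -/
def unifDir (d : ℕ) : Measure (Sph d) :=
  ProbabilityTheory.cond ((volume : Measure (E d)).toSphere) (upperSph d)

/-- `χ(K) = 1` if `K` is nonempty and `χ(∅) = 0`. -/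
def chi {d : ℕ} (K : Set (E d)) : ℝ≥0∞ :=
  open Classical in if K.Nonempty then 1 else 0

/-- `k`-dimensional volume in `ℝ^d`: the `k`-dimensional Hausdorff measure, normalized so that it
is Lebesgue measure on `k`-dimensional affine subspaces (counting measure for `k = 0`). -/
def nu {d : ℕ} (k : ℕ) (K : Set (E d)) : ℝ≥0∞ :=
  (Measure.euclideanHausdorffMeasure k : Measure (E d)) K

section PointProc

variable {Ω S : Type*} [MeasurableSpace Ω] [MeasurableSpace S]

/-- The number of indices `i` with `X i ω ∈ B`, that is, the value at `B` of the counting measure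
`∑ i, δ_(X i ω)`. -/
def pointCount (X : ℕ → Ω → S) (B : Set S) (ω : Ω) : ℝ≥0∞ :=
  ∑' i, B.indicator (fun _ => (1 : ℝ≥0∞)) (X i ω)

/-- The points `X 0, X 1, …` form a Poisson point process with intensity measure `μ`: counts in
sets of finite intensity are Poisson distributed, and counts in disjoint sets are independent. -/
structure IsPoissonProcess (X : ℕ → Ω → S) (μ : Measure S) (P : Measure Ω) : Prop where
  measurable : ∀ i, Measurable (X i)
  poisson : ∀ B : Set S, MeasurableSet B → μ B ≠ ∞ → ∀ n : ℕ,
    P {ω | pointCount X B ω = n} = poissonMeasure (μ B).toNNReal {n}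
  indep : ∀ (m : ℕ) (B : Fin m → Set S), (∀ j, MeasurableSet (B j)) →
    (Pairwise fun i j => Disjoint (B i) (B j)) → iIndepFun (fun j => pointCount X (B j)) P

end PointProc

/-- `X i = (P_i, V_i)` is the parameter representation of a stationary and isotropic Poisson
hyperplane process of intensity `lam` in `ℝ^d`. -/
def IsIsotropicPoissonHyperplaneProcess {Ω : Type*} [MeasurableSpace Ω] (d : ℕ) (lam : ℝ)
    (X : ℕ → Ω → Param d) (P : Measure Ω) : Prop :=
  IsPoissonProcess X (ENNReal.ofReal lam • (volume : Measure ℝ).prod (unifDir d)) P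

section Statistics

variable {Ω : Type*} [MeasurableSpace Ω] {d : ℕ}

/-- The sum of `F(H_1 ∩ … ∩ H_m ∩ B_r)` over all ordered `m`-tuples of pairwise distinct members
of the process, divided by `m!`. -/
def tupleSum (X : ℕ → Ω → Param d) (F : Set (E d) → ℝ≥0∞) (m : ℕ) (r : ℝ) (ω : Ω) : ℝ :=
  (∑' i : Fin m ↪ ℕ, F ((⋂ j, H (X (i j) ω)) ∩ ball d r)).toReal / m !

/-- `Ψ_k(B_r)`: the number of `k`-flats of the intersection process that hit the ball `B_r`. -/
def flatCount (X : ℕ → Ω → Param d) (k : ℕ) (r : ℝ) (ω : Ω) : ℝ :=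
  tupleSum X chi (d - k) r ω

/-- `ζ_k(B_r)`: the total `k`-volume in the ball `B_r` of the `k`-flats of the intersection
process. -/
def totalVol (X : ℕ → Ω → Param d) (k : ℕ) (r : ℝ) (ω : Ω) : ℝ :=
  tupleSum X (nu k) (d - k) r ω

/-- `Z_{k,r}(χ)`: the centred and normalized number of `k`-flats hitting `B_r`. -/
def ZChi (X : ℕ → Ω → Param d) (P : Measure Ω) (lam : ℝ) (k : ℕ) (r : ℝ) (ω : Ω) : ℝ :=
  ((d - k - 1)! : ℝ) / (2 * lam * r) ^ ((d : ℝ) - k - 1 / 2)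
    * (flatCount X k r ω - ∫ ω', flatCount X k r ω' ∂P)

/-- `Z_{k,r}(ν)`: the centred and normalized total `k`-volume of the `k`-flats in `B_r`. -/
def ZNu (X : ℕ → Ω → Param d) (P : Measure Ω) (lam : ℝ) (k : ℕ) (r : ℝ) (ω : Ω) : ℝ :=
  ((d - k - 1)! : ℝ) * (r ^ k)⁻¹ / (2 * lam * r) ^ ((d : ℝ) - k - 1 / 2)
    * (totalVol X k r ω - ∫ ω', totalVol X k r ω' ∂P)

end Statistics

/-- The law of one parameter vector `(P, V)`: `P` is uniform on `[-r, r]`, `V` is uniform on the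
upper hemisphere, and they are independent. -/
def paramLaw (d : ℕ) (r : ℝ) : Measure (Param d) :=
  (ProbabilityTheory.cond (volume : Measure ℝ) (Set.Icc (-r) r)).prod (unifDir d)

/-- `𝔼 F(H(X_1) ∩ … ∩ H(X_m) ∩ H(y) ∩ B_r)` for i.i.d. `X_1, …, X_m` with law `paramLaw d r`. -/
def kernelMean {d : ℕ} (F : Set (E d) → ℝ≥0∞) (m : ℕ) (r : ℝ) (y : Param d) : ℝ :=
  ∫ x : Fin m → Param d, (F ((⋂ j, H (x j)) ∩ H y ∩ ball d r)).toReal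
    ∂(Measure.pi fun _ => paramLaw d r)

/-- `g_{χ,k}`. -/
def gChi (d k : ℕ) (r : ℝ) (y : Param d) : ℝ := kernelMean chi (d - k - 1) r y

/-- `g_{ν,k}`. -/
def gNu (d k : ℕ) (r : ℝ) (y : Param d) : ℝ := (r ^ k)⁻¹ * kernelMean (nu k) (d - k - 1) r y

/-- The matrix `Σ(χ)` of mixed second moments `𝔼 (g_{χ,k}(X_1) g_{χ,l}(X_1))`, `0 ≤ k, l < d`,
computed in the ball of radius `r`. -/
def SigmaChi (d : ℕ) (r : ℝ) : Matrix (Fin d) (Fin d) ℝ :=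
  Matrix.of fun k l => ∫ y, gChi d k r y * gChi d l r y ∂(paramLaw d r)

/-- The matrix `Σ(ν)` of mixed second moments `𝔼 (g_{ν,k}(X_1) g_{ν,l}(X_1))`, `0 ≤ k, l < d`,
computed in the ball of radius `r`. -/
def SigmaNu (d : ℕ) (r : ℝ) : Matrix (Fin d) (Fin d) ℝ :=
  Matrix.of fun k l => ∫ y, gNu d k r y * gNu d l r y ∂(paramLaw d r)

end PoissonHyperplanes

end

/-! Both statistics are sums over tuples of distinct hyperplanes of one quantity, `capSup a r K`,
the supremum of `(1 - |z|²/r²)^(a/2)` over `z ∈ K` with `|z| ≤ r`. For `a = 0` it is the indicator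
that `K` hits the ball. For a flat of dimension `k` and `a = k` it is the volume of the section
divided by that of a `k`-ball of radius `r`. Hyperplanes are almost surely in general position, so
`ζ_k` reduces to this case as well.

Covariances come from the Campbell formula `lintegral_tsum_embedding`. A product of two sums is
sorted by the entries that the tuples share. With `c = 2λr`, disjoint tuples of lengths `m + 1` and
`n + 1` give the product of the means, tuples with one common hyperplane give `(m+1)(n+1) c^(m+n+1)`
times the mixed moment of the conditional means `sectionMean`, and all others together are
`O(c^(m+n))`. After normalization the covariance is the mixed moment up to `O(1/r)`
(`integral_normSum_mul`).

The conditional mean is explicit up to a constant. The hyperplane at signed distance `p` cuts the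
ball in a ball of radius `s r`, where `s = √(1 - p²/r²)`. Translation, scaling and rotation of the
hyperplane measure then yield `A s^(a+q)` with `A > 0`, where `q` is the number of remaining
hyperplanes (`exists_sectionMean_eq`).

For `χ` the exponent is `d - k - 1`. It differs from one `k` to another, so the Gram matrix of these
linearly independent functions has full rank. For `ν` it is `k + (d - k - 1) = d - 1` for every `k`,
so all conditional means are proportional. Hence the rank is one, the second moment of the
standardized difference tends to zero, and Chebyshev's inequality finishes. -/

noncomputable section

namespace PoissonHyperplanes

/-! ### Factorial moments and the multivariate Campbell formula for Poisson processes. -/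

section Campbell

instance countable_embedding_nat {ι : Type*} [Finite ι] : Countable (ι ↪ ℕ) :=
  DFunLike.coe_injective.countable

/-- The factorial moments of the Poisson distribution are powers of the rate. -/
theorem lintegral_descFactorial_poissonMeasure (r : NNReal) (k : ℕ) :
    ∫⁻ n, (n.descFactorial k : ℝ≥0∞) ∂(poissonMeasure r) = (r : ℝ≥0∞) ^ k := by
  rw [lintegral_countable', ← ENNReal.summable.sum_add_tsum_nat_add' (k := k)]
  have h0 : ∑ i ∈ Finset.range k, ((i.descFactorial k : ℕ) : ℝ≥0∞) * poissonMeasure r {i} = 0 := by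
    refine Finset.sum_eq_zero fun i hi => ?_
    rw [Nat.descFactorial_of_lt (Finset.mem_range.1 hi)]
    simp
  -- The falling factorial vanishes below `k`; above, it cancels part of `(n + k)!`, leaving a
  -- shifted Poisson series.
  have h1 : ∀ n : ℕ, (((n + k).descFactorial k : ℕ) : ℝ≥0∞) * poissonMeasure r {n + k}
      = (r : ℝ≥0∞) ^ k * poissonMeasure r {n} := by
    intro n
    rw [poissonMeasure_singleton, poissonMeasure_singleton, ← ENNReal.ofReal_natCast,
      ← ENNReal.ofReal_coe_nnreal, ← ENNReal.ofReal_pow (NNReal.coe_nonneg _),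
      ← ENNReal.ofReal_mul (by positivity), ← ENNReal.ofReal_mul (by positivity)]
    congr 1
    have h2 : (n ! * (n + k).descFactorial k : ℕ) = (n + k)! := by
      have := Nat.factorial_mul_descFactorial (n := n + k) (k := k) (by omega)
      simpa using this
    have h3 : ((n + k)! : ℝ) = n ! * (n + k).descFactorial k := by exact_mod_cast h2.symm
    have h4 : ((n + k)! : ℝ) ≠ 0 := by positivity
    have h5 : (n ! : ℝ) ≠ 0 := by positivity
    have h6 : ((n + k).descFactorial k : ℝ) ≠ 0 := by
      intro h; rw [h, mul_zero] at h3; exact h4 h3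
    rw [h3]
    field_simp
    ring
  have h2 : ∑' n, poissonMeasure r {n} = 1 := by
    have := lintegral_countable' (μ := poissonMeasure r) (fun _ : ℕ => (1 : ℝ≥0∞))
    simpa using this.symm
  simp_rw [h0, h1, ENNReal.tsum_mul_left, h2]
  simp

variable {ι T : Type*} [Fintype ι]

/-- The number of injections `e` of a finite type with `e j ∈ I (σ j)`, for disjoint sets `I t`. -/
theorem tsum_embedding_prod_indicator [Fintype T] [DecidableEq T] (I : T → Set ℕ)
    (hfin : ∀ t, (I t).Finite) (hI : Pairwise fun s t => Disjoint (I s) (I t)) (σ : ι → T) :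
    ∑' e : ι ↪ ℕ, ∏ j, (I (σ j)).indicator (fun _ => (1 : ℝ≥0∞)) (e j)
      = ∏ t, ((I t).ncard.descFactorial (Fintype.card {j // σ j = t}) : ℝ≥0∞) := by
  classical
  have h1 : ∀ e : ι ↪ ℕ, ∏ j, (I (σ j)).indicator (fun _ => (1 : ℝ≥0∞)) (e j)
      = {e : ι ↪ ℕ | ∀ j, e j ∈ I (σ j)}.indicator (fun _ => 1) e := by
    intro e
    by_cases h : ∀ j, e j ∈ I (σ j)
    · rw [Set.indicator_of_mem (by exact h)]
      exact Finset.prod_eq_one fun j _ => Set.indicator_of_mem (h j) _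
    · rw [Set.indicator_of_notMem (by exact h)]
      push Not at h
      obtain ⟨j, hj⟩ := h
      exact Finset.prod_eq_zero (Finset.mem_univ j) (Set.indicator_of_notMem hj _)
  have hft : ∀ t, Fintype (I t) := fun t => (hfin t).fintype
  -- An admissible injection is a family of injections on the fibres of `σ`; disjointness of the
  -- sets `I t` makes the glued map injective.
  let F : {e : ι ↪ ℕ | ∀ j, e j ∈ I (σ j)} ≃ ((t : T) → ({j // σ j = t} ↪ I t)) :=
    { toFun := fun e t => ⟨fun j => ⟨e.1 j, by have := e.2 j.1; rw [j.2] at this; exact this⟩,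
        fun a b hab => Subtype.ext (e.1.injective (congrArg Subtype.val hab))⟩
      invFun := fun f => ⟨⟨fun j => (f (σ j) ⟨j, rfl⟩ : ℕ), by
          intro a b hab
          have hs : σ a = σ b := by
            by_contra hne
            exact Set.disjoint_left.1 (hI hne) (f (σ a) ⟨a, rfl⟩).2 (by
              have : (f (σ a) ⟨a, rfl⟩ : ℕ) = f (σ b) ⟨b, rfl⟩ := hab
              rw [this]; exact (f (σ b) ⟨b, rfl⟩).2)
          have key : ∀ t (ha : σ a = t) (hb : σ b = t),
              (f t ⟨a, ha⟩ : ℕ) = f t ⟨b, hb⟩ → a = b := by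
            intro t ha hb h
            have := (f t).injective (Subtype.ext h)
            exact congrArg Subtype.val this
          have e1 : ∀ t (hb : σ b = t), (f (σ b) ⟨b, rfl⟩ : ℕ) = f t ⟨b, hb⟩ := by
            rintro t rfl; rfl
          exact key (σ a) rfl hs.symm ((show (f (σ a) ⟨a, rfl⟩ : ℕ) = f (σ b) ⟨b, rfl⟩ from hab).trans
            (e1 _ hs.symm))⟩, fun j => (f (σ j) ⟨j, rfl⟩).2⟩
      left_inv := fun e => rfl
      right_inv := fun f => by
        funext t; ext ⟨j, hj⟩; subst hj; rfl }
  simp_rw [h1]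
  rw [← tsum_subtype, ENNReal.tsum_one, ENat.card_congr F, ENat.card_eq_coe_fintype_card,
    Fintype.card_pi]
  rw [ENat.toENNReal_coe, Nat.cast_prod]
  refine Finset.prod_congr rfl fun t _ => ?_
  rw [Fintype.card_embedding_eq, ← Nat.card_coe_set_eq, Nat.card_eq_fintype_card]

theorem pointCount_eq_encard {Ω S : Type*} (X : ℕ → Ω → S) (B : Set S) (ω : Ω) :
    pointCount X B ω = ({i | X i ω ∈ B}.encard : ℝ≥0∞) := by
  rw [← ENNReal.tsum_set_one, tsum_subtype {i | X i ω ∈ B} fun _ => (1 : ℝ≥0∞)]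
  rfl

variable {Ω S : Type*} [MeasurableSpace Ω] [MeasurableSpace S] {X : ℕ → Ω → S} {μ : Measure S}
  {P : Measure Ω}

namespace IsPoissonProcess

theorem measurable_pointCount (hX : IsPoissonProcess X μ P) {B : Set S} (hB : MeasurableSet B) :
    Measurable (pointCount X B) :=
  Measurable.tsum fun i => (measurable_const.indicator hB).comp (hX.measurable i)

/-- The Poisson weights already sum to one, so no mass is left for an infinite count. -/
theorem ae_exists_pointCount_eq [IsProbabilityMeasure P] (hX : IsPoissonProcess X μ P) {B : Set S}
    (hB : MeasurableSet B) (hμ : μ B ≠ ∞) : ∀ᵐ ω ∂P, ∃ n : ℕ, pointCount X B ω = n := by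
  have hm : ∀ n : ℕ, MeasurableSet {ω | pointCount X B ω = n} := fun n =>
    hX.measurable_pointCount hB (measurableSet_singleton _)
  have h1 : {ω | ∃ n : ℕ, pointCount X B ω = n} = ⋃ n : ℕ, {ω | pointCount X B ω = n} := by
    ext; simp
  have h2 : P {ω | ∃ n : ℕ, pointCount X B ω = n} = 1 := by
    rw [h1, measure_iUnion _ hm]
    · simp_rw [hX.poisson B hB hμ]
      have := lintegral_countable' (μ := poissonMeasure (μ B).toNNReal) (fun _ : ℕ => (1 : ℝ≥0∞))
      simpa using this.symm
    · intro a b hab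
      refine Set.disjoint_left.2 fun ω ha hb => hab ?_
      have : (a : ℝ≥0∞) = b := by rw [← show pointCount X B ω = a from ha]; exact hb
      exact_mod_cast this
  exact mem_ae_iff_prob_eq_one (h1 ▸ MeasurableSet.iUnion hm) |>.2 h2

/-- The factorial moments of the number of points in a set of finite intensity. -/
theorem lintegral_descFactorial_pointCount [IsProbabilityMeasure P] (hX : IsPoissonProcess X μ P)
    {B : Set S} (hB : MeasurableSet B) (hμ : μ B ≠ ∞) (k : ℕ) :
    ∫⁻ ω, (⌊(pointCount X B ω).toReal⌋₊.descFactorial k : ℝ≥0∞) ∂P = μ B ^ k := by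
  have hf : Measurable fun ω => ⌊(pointCount X B ω).toReal⌋₊ :=
    Nat.measurable_floor.comp (hX.measurable_pointCount hB).ennreal_toReal
  have hmap : P.map (fun ω => ⌊(pointCount X B ω).toReal⌋₊) = poissonMeasure (μ B).toNNReal := by
    refine Measure.ext_of_singleton fun n => ?_
    rw [Measure.map_apply hf (measurableSet_singleton n), ← hX.poisson B hB hμ n]
    refine measure_congr ?_
    filter_upwards [hX.ae_exists_pointCount_eq hB hμ] with ω ⟨m, hm⟩
    apply propext
    change ⌊(pointCount X B ω).toReal⌋₊ = n ↔ pointCount X B ω = n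
    rw [hm]
    simp
  rw [← lintegral_map (f := fun n : ℕ => (n.descFactorial k : ℝ≥0∞)) (measurable_of_countable _) hf, hmap,
    lintegral_descFactorial_poissonMeasure, ENNReal.coe_toNNReal hμ]

/-- The sum counts injections into disjoint index sets, so it is a product of falling factorials of
independent Poisson counts, and each factorial moment is a power of the intensity. -/
theorem lintegral_tsum_prod_indicator_of_disjoint [IsProbabilityMeasure P]
    [Fintype T] (hX : IsPoissonProcess X μ P)
    (A : T → Set S) (hA : ∀ t, MeasurableSet (A t)) (hfin : ∀ t, μ (A t) ≠ ∞)
    (hdis : Pairwise fun s t => Disjoint (A s) (A t)) (σ : ι → T) :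
    ∫⁻ ω, ∑' e : ι ↪ ℕ, ∏ j, (A (σ j)).indicator (fun _ => (1 : ℝ≥0∞)) (X (e j) ω) ∂P
      = ∏ j, μ (A (σ j)) := by
  classical
  have h1 : ∀ᵐ ω ∂P, ∑' e : ι ↪ ℕ, ∏ j, (A (σ j)).indicator (fun _ => (1 : ℝ≥0∞)) (X (e j) ω)
      = ∏ t, (⌊(pointCount X (A t) ω).toReal⌋₊.descFactorial (Fintype.card {j // σ j = t})
          : ℝ≥0∞) := by
    have h2 := ae_all_iff.2 fun t => hX.ae_exists_pointCount_eq (hA t) (hfin t)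
    filter_upwards [h2] with ω hω
    have hf : ∀ t, {i | X i ω ∈ A t}.Finite := by
      intro t
      obtain ⟨n, hn⟩ := hω t
      rw [pointCount_eq_encard] at hn
      refine Set.finite_of_encard_eq_coe (k := n) ?_
      exact_mod_cast hn
    have := tsum_embedding_prod_indicator (fun t => {i | X i ω ∈ A t}) hf
      (fun s t hst => Set.disjoint_left.2 fun i hi hi' =>
        Set.disjoint_left.1 (hdis hst) hi hi') σ
    have h3 : ∀ t, ⌊(pointCount X (A t) ω).toReal⌋₊ = {i | X i ω ∈ A t}.ncard := by
      intro t
      rw [pointCount_eq_encard, ← (hf t).cast_ncard_eq]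
      simp
    simp_rw [h3]
    exact this
  rw [lintegral_congr_ae h1]
  have hind : iIndepFun (fun t => pointCount X (A t)) P := by
    have e := Fintype.equivFin T
    have := hX.indep (Fintype.card T) (fun j => A (e.symm j)) (fun j => hA _)
      (fun i j hij => hdis (e.symm.injective.ne hij))
    have := this.precomp e.injective
    simpa using this
  have hmeas : ∀ k : ℕ, Measurable fun x : ℝ≥0∞ => (⌊x.toReal⌋₊.descFactorial k : ℝ≥0∞) :=
    fun k => (measurable_of_countable (fun n : ℕ => (n.descFactorial k : ℝ≥0∞))).comp
      (Nat.measurable_floor.comp ENNReal.measurable_toReal)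
  rw [lintegral_prod_eq_prod_lintegral_of_indepFun Finset.univ
    (fun t ω => (⌊(pointCount X (A t) ω).toReal⌋₊.descFactorial (Fintype.card {j // σ j = t})
          : ℝ≥0∞)) (hind.comp (fun t x => (⌊x.toReal⌋₊.descFactorial (Fintype.card {j // σ j = t})
          : ℝ≥0∞)) fun t => hmeas _)
    (fun t => (hmeas _).comp (hX.measurable_pointCount (hA t)))]
  simp_rw [hX.lintegral_descFactorial_pointCount (hA _) (hfin _)]
  rw [← Finset.prod_fiberwise (s := Finset.univ) (g := σ) (f := fun j => μ (A (σ j)))]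
  refine Finset.prod_congr rfl fun t _ => ?_
  rw [Finset.prod_congr rfl (g := fun _ => μ (A t)) (fun j hj => by
    rw [(Finset.mem_filter.1 hj).2]), Finset.prod_const, Fintype.card_subtype]

/-- The factorial moment measure of a Poisson process on a product set. -/
theorem lintegral_tsum_prod_indicator [IsProbabilityMeasure P] (hX : IsPoissonProcess X μ P)
    (B : ι → Set S) (hB : ∀ j, MeasurableSet (B j)) (hfin : ∀ j, μ (B j) ≠ ∞) :
    ∫⁻ ω, ∑' e : ι ↪ ℕ, ∏ j, (B j).indicator (fun _ => (1 : ℝ≥0∞)) (X (e j) ω) ∂P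
      = ∏ j, μ (B j) := by
  classical
  -- The atoms of the algebra generated by the sets `B j`, without the one outside all of them,
  -- whose intensity may be infinite. Expanding the indicators over atoms reduces to the disjoint
  -- case.
  let T := {t : ι → Bool // ∃ j, t j = true}
  let A : T → Set S := fun t => {x | ∀ j, x ∈ B j ↔ t.1 j = true}
  have hA : ∀ t, MeasurableSet (A t) := by
    intro t
    have : A t = ⋂ j, (if t.1 j then B j else (B j)ᶜ) := by
      ext x
      simp only [A, Set.mem_ofPred_eq, Set.mem_iInter]
      refine forall_congr' fun j => ?_
      by_cases h : t.1 j = true <;> simp [h]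
    rw [this]
    refine MeasurableSet.iInter fun j => ?_
    split_ifs
    exacts [hB j, (hB j).compl]
  have hAfin : ∀ t, μ (A t) ≠ ∞ := by
    rintro ⟨t, j, hj⟩
    refine ne_top_of_le_ne_top (hfin j) (measure_mono fun x hx => ?_)
    exact (hx j).2 hj
  have hdis : Pairwise fun s t => Disjoint (A s) (A t) := by
    intro s t hst
    refine Set.disjoint_left.2 fun x hx hx' => hst ?_
    apply Subtype.ext
    funext j
    have := (hx j).symm.trans (hx' j)
    exact Bool.eq_iff_iff.2 this
  let F : ι → Finset T := fun j => Finset.univ.filter fun t => t.1 j = true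
  have hsum : ∀ j x, (B j).indicator (fun _ => (1 : ℝ≥0∞)) x
      = ∑ t ∈ F j, (A t).indicator (fun _ => (1 : ℝ≥0∞)) x := by
    intro j x
    by_cases hx : x ∈ B j
    · let t : T := ⟨fun i => decide (x ∈ B i), j, by simpa using hx⟩
      have ht : x ∈ A t := fun i => by simp [t]
      rw [Set.indicator_of_mem hx, Finset.sum_eq_single t, Set.indicator_of_mem ht]
      · intro s _ hs
        exact Set.indicator_of_notMem (fun h => Set.disjoint_left.1 (hdis hs) h ht) _
      · intro h
        exact absurd (by simpa [F, t] using hx) h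
    · rw [Set.indicator_of_notMem hx, Finset.sum_eq_zero]
      intro t ht
      refine Set.indicator_of_notMem (fun h => hx ((h j).2 ?_)) _
      simpa [F] using ht
  have hmeas : ∀ σ : ι → T, Measurable fun ω => ∑' e : ι ↪ ℕ,
      ∏ j, (A (σ j)).indicator (fun _ => (1 : ℝ≥0∞)) (X (e j) ω) := fun σ =>
    Measurable.tsum fun e => Finset.measurable_prod _ fun j _ =>
      (measurable_const.indicator (hA _)).comp (hX.measurable _)
  simp_rw [hsum, Finset.prod_univ_sum]
  have hswap : ∀ ω, ∑' e : ι ↪ ℕ, ∑ σ ∈ Fintype.piFinset F,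
        ∏ j, (A (σ j)).indicator (fun _ => (1 : ℝ≥0∞)) (X (e j) ω)
      = ∑ σ ∈ Fintype.piFinset F, ∑' e : ι ↪ ℕ,
        ∏ j, (A (σ j)).indicator (fun _ => (1 : ℝ≥0∞)) (X (e j) ω) := fun ω =>
    Summable.tsum_finsetSum fun _ _ => ENNReal.summable
  simp_rw [hswap]
  rw [lintegral_finsetSum _ fun σ _ => hmeas σ]
  simp_rw [hX.lintegral_tsum_prod_indicator_of_disjoint A hA hAfin hdis]
  rw [← Finset.prod_univ_sum F (fun _ t => μ (A t))]
  refine Finset.prod_congr rfl fun j _ => ?_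
  have h1 : ∀ x, (B j).indicator (1 : S → ℝ≥0∞) x = ∑ t ∈ F j, (A t).indicator 1 x :=
    fun x => hsum j x
  rw [← lintegral_indicator_one (hB j)]
  simp_rw [h1]
  rw [lintegral_finsetSum _ fun t _ => measurable_one.indicator (hA t)]
  simp_rw [lintegral_indicator_one (hA _)]

/-- **Multivariate Campbell formula** for functions supported in a product of sets of finite
intensity. -/
theorem lintegral_tsum_embedding [IsProbabilityMeasure P] (hX : IsPoissonProcess X μ P)
    {B : Set S} (hB : MeasurableSet B) (hμ : μ B ≠ ∞) {f : (ι → S) → ℝ≥0∞} (hf : Measurable f)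
    (hsupp : ∀ x, f x ≠ 0 → ∀ j, x j ∈ B) :
    ∫⁻ ω, ∑' e : ι ↪ ℕ, f (fun j => X (e j) ω) ∂P
      = ∫⁻ x, f x ∂(Measure.pi fun _ : ι => μ.restrict B) := by
  classical
  have : IsFiniteMeasure (μ.restrict B) := ⟨by simpa using hμ.lt_top⟩
  have hXm : ∀ e : ι ↪ ℕ, Measurable fun ω => fun j => X (e j) ω :=
    fun e => measurable_pi_lambda _ fun j => hX.measurable _
  let C : Set (ι → S) := Set.univ.pi fun _ => B
  have hC : MeasurableSet C := MeasurableSet.univ_pi fun _ => hB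
  -- The factorial moment measure restricted to `B^ι`. It agrees with the product measure on
  -- rectangles, hence everywhere.
  let ν : Measure (ι → S) :=
    Measure.sum fun e : ι ↪ ℕ => (P.map fun ω j => X (e j) ω).restrict C
  have hν : ν = Measure.pi fun _ : ι => μ.restrict B := by
    refine (Measure.pi_eq fun s hs => ?_).symm
    rw [Measure.sum_apply _ (MeasurableSet.univ_pi hs)]
    have := hX.lintegral_tsum_prod_indicator (fun j => s j ∩ B) (fun j => (hs j).inter hB)
      (fun j => ne_top_of_le_ne_top hμ (measure_mono Set.inter_subset_right))
    simp_rw [Measure.restrict_apply (hs _)]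
    rw [← this, lintegral_tsum (f := fun (e : ι ↪ ℕ) ω =>
      ∏ j, (s j ∩ B).indicator (fun _ => (1 : ℝ≥0∞)) (X (e j) ω)) fun e => (Finset.measurable_prod _ fun j _ =>
      (measurable_const.indicator ((hs j).inter hB)).comp (hX.measurable _)).aemeasurable]
    refine tsum_congr fun e => ?_
    rw [Measure.restrict_apply (MeasurableSet.univ_pi hs),
      Measure.map_apply (hXm e) ((MeasurableSet.univ_pi hs).inter hC),
      ← lintegral_indicator_one (hXm e ((MeasurableSet.univ_pi hs).inter hC))]
    refine lintegral_congr fun ω => ?_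
    by_cases h : ∀ j, X (e j) ω ∈ s j ∩ B
    · rw [Set.indicator_of_mem, Finset.prod_eq_one]
      · rfl
      · exact fun j _ => Set.indicator_of_mem (h j) _
      · exact ⟨fun j _ => (h j).1, fun j _ => (h j).2⟩
    · rw [Set.indicator_of_notMem]
      · push Not at h
        obtain ⟨j, hj⟩ := h
        exact (Finset.prod_eq_zero (Finset.mem_univ j) (Set.indicator_of_notMem hj _)).symm
      · exact fun h' => h fun j => ⟨h'.1 j trivial, h'.2 j trivial⟩
  rw [← hν, lintegral_sum_measure, lintegral_tsum (f := fun (e : ι ↪ ℕ) ω => f fun j => X (e j) ω)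
    fun e => (hf.comp (hXm e)).aemeasurable]
  refine tsum_congr fun e => ?_
  rw [← lintegral_indicator hC, lintegral_map (hf.indicator hC) (hXm e)]
  refine lintegral_congr fun ω => ?_
  by_cases h : (fun j => X (e j) ω) ∈ C
  · rw [Set.indicator_of_mem h]
  · rw [Set.indicator_of_notMem h]
    by_contra h0
    exact h fun j _ => hsupp _ h0 j

end IsPoissonProcess

end Campbell

/-! ### Combinatorics of pairs of injective tuples with common entries. -/

section Overlap

/-- A way in which an injective `β`-tuple may overlap with an injective `α`-tuple: `h b = some a`
if the entry `b` of the second coincides with the entry `a` of the first. -/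
abbrev Overlap (α β : Type*) : Type _ :=
  {h : β → Option α // ∀ b b' a, h b = some a → h b' = some a → b = b'}

namespace Overlap

variable {α β : Type*}

instance [Finite α] [Finite β] : Finite (Overlap α β) := Subtype.finite

instance [Finite α] [Finite β] : Fintype (Overlap α β) := Fintype.ofFinite _

/-- The index type of the union of two tuples with overlap `h`. -/
abbrev Index (h : Overlap α β) : Type _ := α ⊕ {b // h.1 b = none}

instance [Finite β] (h : Overlap α β) : Fintype {b // h.1 b = none} :=
  Fintype.ofFinite _

/-- The position of the entry `b` of the second tuple in the union of the two tuples. -/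
def pos (h : Overlap α β) (b : β) : h.Index :=
  match hb : h.1 b with
  | some a => Sum.inl a
  | none => Sum.inr ⟨b, hb⟩

theorem pos_of_some (h : Overlap α β) {b : β} {a : α} (hb : h.1 b = some a) :
    h.pos b = Sum.inl a := by
  unfold pos
  split
  · rename_i a' h'
    rw [hb] at h'
    simp only [Option.some.injEq] at h'
    rw [h']
  · rename_i h'
    rw [hb] at h'
    exact absurd h' (by simp)

theorem pos_of_none (h : Overlap α β) {b : β} (hb : h.1 b = none) :
    h.pos b = Sum.inr ⟨b, hb⟩ := by
  unfold pos
  split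
  · rename_i a' h'
    rw [hb] at h'
    exact absurd h' (by simp)
  · rfl

theorem pos_injective (h : Overlap α β) : Function.Injective h.pos := by
  intro b b' hbb
  rcases hb : h.1 b with _ | a <;> rcases hb' : h.1 b' with _ | a'
  · rw [h.pos_of_none hb, h.pos_of_none hb'] at hbb
    simpa using hbb
  · rw [h.pos_of_none hb, h.pos_of_some hb'] at hbb
    simp at hbb
  · rw [h.pos_of_some hb, h.pos_of_none hb'] at hbb
    simp at hbb
  · rw [h.pos_of_some hb, h.pos_of_some hb'] at hbb
    simp only [Sum.inl.injEq] at hbb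
    subst hbb
    exact h.2 b b' a hb hb'

/-- The pair of tuples obtained from an overlap and a tuple indexed by the union. -/
def toPair (s : Σ h : Overlap α β, h.Index ↪ ℕ) : (α ↪ ℕ) × (β ↪ ℕ) :=
  (Function.Embedding.inl.trans s.2, Function.Embedding.trans ⟨s.1.pos, s.1.pos_injective⟩ s.2)

/-- The pair `(i, j)` determines the overlap, because `h b = some a` exactly when `j b = i a`; the
union tuple then lists `i` followed by the values of `j` not taken by `i`. -/
theorem toPair_bijective : Function.Bijective (toPair (α := α) (β := β)) := by
  classical
  constructor
  · rintro ⟨h, e⟩ ⟨h', e'⟩ heq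
    have h1 : ∀ a, e (Sum.inl a) = e' (Sum.inl a) := fun a =>
      DFunLike.congr_fun (congrArg Prod.fst heq) a
    have h2 : ∀ b, e (h.pos b) = e' (h'.pos b) := fun b =>
      DFunLike.congr_fun (congrArg Prod.snd heq) b
    have key : ∀ (g : Overlap α β) (k : g.Index ↪ ℕ) (b : β) (a : α),
        g.1 b = some a ↔ k (g.pos b) = k (Sum.inl a) := by
      intro g k b a
      constructor
      · intro hb
        rw [g.pos_of_some hb]
      · intro hk
        have hp := k.injective hk
        rcases hb : g.1 b with _ | a'
        · rw [g.pos_of_none hb] at hp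
          simp at hp
        · rw [g.pos_of_some hb] at hp
          simp only [Sum.inl.injEq] at hp
          rw [hp]
    have hh : h = h' := by
      apply Subtype.ext
      funext b
      apply Option.ext
      intro a
      have := (key h e b a).trans (by rw [h1, h2])
      exact this.trans (key h' e' b a).symm
    subst hh
    have he : e = e' := by
      ext x
      rcases x with a | ⟨b, hb⟩
      · exact h1 a
      · have := h2 b
        rwa [h.pos_of_none hb] at this
    rw [he]
  · rintro ⟨i, j⟩
    let h0 : β → Option α := fun b =>
      if hb : ∃ a, i a = j b then some hb.choose else none
    have hsome : ∀ b a, h0 b = some a → i a = j b := by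
      intro b a hb
      by_cases hex : ∃ a, i a = j b
      · simp only [h0, dif_pos hex, Option.some.injEq] at hb
        rw [← hb]
        exact hex.choose_spec
      · simp [h0, dif_neg hex] at hb
    have hnone : ∀ b, h0 b = none → ∀ a, i a ≠ j b := by
      intro b hb a ha
      have hex : ∃ a, i a = j b := ⟨a, ha⟩
      simp [h0, dif_pos hex] at hb
    let h : Overlap α β := ⟨h0, fun b b' a hb hb' =>
      j.injective ((hsome b a hb).symm.trans (hsome b' a hb'))⟩
    let e : h.Index ↪ ℕ := ⟨Sum.elim i fun b => j b.1, by
      rintro (a | b) (a' | b') hab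
      · exact congrArg Sum.inl (i.injective hab)
      · exact absurd hab (hnone b'.1 b'.2 a)
      · exact absurd hab.symm (hnone b.1 b.2 a')
      · exact congrArg Sum.inr (Subtype.ext (j.injective hab))⟩
    refine ⟨⟨h, e⟩, Prod.ext ?_ ?_⟩
    · ext a
      rfl
    · ext b
      change e (h.pos b) = j b
      rcases hb : h.1 b with _ | a
      · rw [h.pos_of_none hb]
        rfl
      · rw [h.pos_of_some hb]
        exact hsome b a hb

/-- The product of two sums over injective tuples, sorted by the overlap of the tuples. -/
theorem tsum_mul_tsum [Finite α] [Finite β] (F : (α → ℕ) → ℝ≥0∞) (G : (β → ℕ) → ℝ≥0∞) :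
    (∑' i : α ↪ ℕ, F i) * (∑' j : β ↪ ℕ, G j)
      = ∑ h : Overlap α β, ∑' e : h.Index ↪ ℕ, F (fun a => e (Sum.inl a)) * G (fun b => e (h.pos b)) := by
  rw [← ENNReal.tsum_mul_right]
  simp_rw [← ENNReal.tsum_mul_left]
  rw [← ENNReal.tsum_prod (f := fun (i : α ↪ ℕ) (j : β ↪ ℕ) => F i * G j),
    ← (Equiv.ofBijective _ (toPair_bijective (α := α) (β := β))).tsum_eq, ENNReal.tsum_sigma',
    tsum_fintype]
  rfl

/-- The empty overlap. -/
def empty : Overlap α β := ⟨fun _ => none, by simp⟩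

/-- The overlap in which exactly the entries `a` and `b` coincide. -/
def single [DecidableEq β] (p : α × β) : Overlap α β :=
  ⟨fun b => if b = p.2 then some p.1 else none, by
    intro b b' a hb hb'
    dsimp only at hb hb'
    split_ifs at hb hb' with h1 h2
    rw [h1, h2]⟩

theorem single_injective [DecidableEq β] : Function.Injective (single (α := α) (β := β)) := by
  rintro ⟨a, b⟩ ⟨a', b'⟩ hab
  have h1 := congrFun (congrArg Subtype.val hab) b
  simp only [single, if_true] at h1
  split_ifs at h1 with h2
  simp only [Option.some.injEq] at h1
  rw [h1, h2]

theorem single_ne_empty [DecidableEq β] (p : α × β) : single p ≠ empty := by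
  intro h
  have h1 := congrFun (congrArg Subtype.val h) p.2
  simp [single, empty] at h1

theorem card_index_empty [Fintype α] [Fintype β] :
    Fintype.card (empty : Overlap α β).Index = Fintype.card α + Fintype.card β := by
  classical
  rw [Fintype.card_sum]
  congr 1
  exact Fintype.card_congr (Equiv.subtypeUnivEquiv fun _ => rfl)

theorem card_index_single [DecidableEq β] [Fintype α] [Fintype β] (p : α × β) :
    Fintype.card (single p).Index + 1 = Fintype.card α + Fintype.card β := by
  have h1 : Fintype.card {b // (single p).1 b = none} = Fintype.card {b // b ≠ p.2} :=
    Fintype.card_congr (Equiv.subtypeEquivRight fun b => by simp [single])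
  have h2 : Fintype.card {b // b ≠ p.2} = Fintype.card β - 1 := by
    rw [Fintype.card_subtype_compl, Fintype.card_subtype_eq]
  have h3 : 0 < Fintype.card β := Fintype.card_pos_iff.2 ⟨p.2⟩
  rw [Fintype.card_sum, h1, h2]
  omega

/-- Such an overlap has at least two coincidences, and each lowers the number of distinct entries by
one. This makes the corresponding terms of the second moment negligible. -/
theorem card_index_le [DecidableEq β] [Fintype α] [Fintype β] (h : Overlap α β) (h0 : h ≠ empty)
    (h1 : ∀ p, h ≠ single p) : Fintype.card h.Index + 2 ≤ Fintype.card α + Fintype.card β := by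
  rw [Fintype.card_sum]
  have h2 : Fintype.card {b // h.1 b = none} + Fintype.card {b // ¬ h.1 b = none}
      = Fintype.card β := by
    rw [← Fintype.card_sum]
    exact Fintype.card_congr (Equiv.sumCompl _)
  have h3 : 1 < Fintype.card {b // ¬ h.1 b = none} := by
    have hex : ∃ b, h.1 b ≠ none := by
      by_contra hcon
      push Not at hcon
      exact h0 (Subtype.ext (funext hcon))
    obtain ⟨b, hb⟩ := hex
    obtain ⟨a, ha⟩ := Option.ne_none_iff_exists'.1 hb
    have hex2 : ∃ b', b' ≠ b ∧ h.1 b' ≠ none := by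
      by_contra hcon
      push Not at hcon
      refine h1 (a, b) (Subtype.ext (funext fun b' => ?_))
      by_cases hbb : b' = b
      · simp [single, hbb, ha]
      · simp [single, hbb, hcon b' hbb]
    obtain ⟨b', hne, hb'⟩ := hex2
    exact Fintype.one_lt_card_iff.2 ⟨⟨b', hb'⟩, ⟨b, hb⟩, fun he => hne (congrArg Subtype.val he)⟩
  omega

/-- A sum over all overlaps, split according to the number of coincidences. -/
theorem sum_eq [DecidableEq β] [Fintype α] [Fintype β] (Q : Overlap α β → ℝ≥0∞) :
    ∃ s : Finset (Overlap α β), (∀ h ∈ s, h ≠ empty ∧ ∀ p, h ≠ single p) ∧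
      ∑ h, Q h = Q empty + ∑ p : α × β, Q (single p) + ∑ h ∈ s, Q h := by
  classical
  let f : Option (α × β) → Overlap α β := fun o => o.elim empty single
  have hf : Function.Injective f := by
    rintro (_ | p) (_ | p') hpp
    · rfl
    · exact absurd hpp.symm (single_ne_empty p')
    · exact absurd hpp (single_ne_empty p)
    · exact congrArg some (single_injective hpp)
  refine ⟨(Finset.univ.image f)ᶜ, fun h hh => ?_, ?_⟩
  · rw [Finset.mem_compl, Finset.mem_image] at hh
    push Not at hh
    exact ⟨fun e => hh none (Finset.mem_univ _) e.symm,
      fun p e => hh (some p) (Finset.mem_univ _) e.symm⟩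
  · rw [← Finset.sum_add_sum_compl (Finset.univ.image f), Finset.sum_image hf.injOn,
      Fintype.sum_option]
    rfl

end Overlap

end Overlap

/-! ### Integrals over product spaces, for tuples sharing no entry or one entry. -/

section PiIntegrals

variable {S : Type*} [MeasurableSpace S]

theorem measurePreserving_comp_equiv {ι κ : Type*} [Fintype ι] [Fintype κ] (ν : Measure S)
    [SigmaFinite ν] (e : κ ≃ ι) :
    MeasurePreserving (fun x : ι → S => fun k => x (e k)) (Measure.pi fun _ => ν)
      (Measure.pi fun _ => ν) := by
  refine ⟨measurable_pi_lambda _ fun k => measurable_pi_apply _, (Measure.pi_eq fun s hs => ?_).symm⟩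
  rw [Measure.map_apply (by fun_prop) (MeasurableSet.univ_pi hs)]
  have : (fun x : ι → S => fun k => x (e k)) ⁻¹' (Set.univ.pi s)
      = Set.univ.pi fun i => s (e.symm i) := by
    ext x
    simp only [Set.mem_preimage, Set.mem_univ_pi]
    exact ⟨fun h i => by simpa using h (e.symm i), fun h k => by simpa using h (e k)⟩
  rw [this, Measure.pi_pi]
  exact e.symm.prod_comp (fun k => ν (s k))

theorem pi_const_smul {ι : Type*} [Fintype ι] (ν : Measure S) [SigmaFinite ν] {c : ℝ≥0∞}
    (hc : c ≠ ∞) :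
    Measure.pi (fun _ : ι => c • ν) = c ^ Fintype.card ι • Measure.pi fun _ : ι => ν := by
  lift c to NNReal using hc
  have : SigmaFinite ((c : ℝ≥0∞) • ν) := inferInstanceAs (SigmaFinite (c • ν))
  refine Measure.pi_eq fun s hs => ?_
  simp [Measure.pi_pi, Finset.prod_mul_distrib, Finset.prod_const]

theorem lintegral_pi_sum {α β : Type*} [Fintype α] [Fintype β] (ν : Measure S) [SigmaFinite ν]
    {f : (α ⊕ β → S) → ℝ≥0∞} (hf : Measurable f) :
    ∫⁻ x, f x ∂(Measure.pi fun _ => ν)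
      = ∫⁻ u : α → S, ∫⁻ w : β → S, f (Sum.elim u w) ∂(Measure.pi fun _ => ν)
          ∂(Measure.pi fun _ => ν) := by
  have h := measurePreserving_sumPiEquivProdPi_symm (fun _ : α ⊕ β => ν)
  rw [← h.lintegral_comp hf]
  refine (lintegral_prod _ (hf.comp h.measurable).aemeasurable).trans ?_
  refine lintegral_congr fun u => lintegral_congr fun w => congrArg f ?_
  funext i
  cases i <;> rfl

theorem lintegral_pi_insertNth {n : ℕ} (ν : Measure S) [SigmaFinite ν] (i : Fin (n + 1))
    {f : (Fin (n + 1) → S) → ℝ≥0∞} (hf : Measurable f) :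
    ∫⁻ x, f x ∂(Measure.pi fun _ => ν)
      = ∫⁻ y, ∫⁻ u : Fin n → S, f (i.insertNth y u) ∂(Measure.pi fun _ => ν) ∂ν := by
  have h := (measurePreserving_piFinSuccAbove (fun _ : Fin (n + 1) => ν) i).symm
  rw [← h.lintegral_comp hf]
  refine (lintegral_prod _ (hf.comp h.measurable).aemeasurable).trans ?_
  rfl

theorem measurable_lintegral_insertNth {n : ℕ} (ν : Measure S) [SigmaFinite ν] (i : Fin (n + 1))
    {f : (Fin (n + 1) → S) → ℝ≥0∞} (hf : Measurable f) :
    Measurable fun y => ∫⁻ u : Fin n → S, f (i.insertNth y u) ∂(Measure.pi fun _ => ν) :=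
  (hf.comp (MeasurableEquiv.piFinSuccAbove (fun _ => S) i).symm.measurable).lintegral_prod_right'

/-- The integral of a product over tuples which share exactly one entry. -/
theorem lintegral_overlap_single {m n : ℕ} (ν : Measure S) [IsProbabilityMeasure ν]
    {f : (Fin (m + 1) → S) → ℝ≥0∞} {g : (Fin (n + 1) → S) → ℝ≥0∞} (hf : Measurable f)
    (hg : Measurable g) {F G : S → ℝ≥0∞}
    (hF : ∀ i y, ∫⁻ u : Fin m → S, f (Fin.insertNth i y u) ∂(Measure.pi fun _ => ν) = F y)
    (hG : ∀ i y, ∫⁻ u : Fin n → S, g (Fin.insertNth i y u) ∂(Measure.pi fun _ => ν) = G y)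
    (p : Fin (m + 1) × Fin (n + 1)) :
    ∫⁻ x, f (fun a => x (Sum.inl a)) * g (fun b => x ((Overlap.single p).pos b))
        ∂(Measure.pi fun _ : (Overlap.single p).Index => ν)
      = ∫⁻ y, F y * G y ∂ν := by
  have hGm : Measurable G := by
    simpa only [hG] using measurable_lintegral_insertNth ν 0 hg
  rw [lintegral_pi_sum ν (by fun_prop)]
  -- Integrating out the entries of the second tuple other than `p.2` leaves its conditional mean
  -- given the shared entry `u p.1`.
  have hinner : ∀ u : Fin (m + 1) → S,
      ∫⁻ w : {b // (Overlap.single p).1 b = none} → S,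
        g (fun b => (Sum.elim u w : _ → S) ((Overlap.single p).pos b))
          ∂(Measure.pi fun _ => ν) = G (u p.1) := by
    intro u
    let e : Fin n ≃ {b // (Overlap.single p).1 b = none} :=
      (finSuccAboveEquiv p.2).trans
        (Equiv.subtypeEquivRight fun b => by simp [Overlap.single])
    have hm : Measurable fun w : Fin n → S => g (p.2.insertNth (u p.1) w) :=
      hg.comp ((MeasurableEquiv.piFinSuccAbove (fun _ => S) p.2).symm.measurable.comp
        measurable_prodMk_left)
    rw [← hG p.2 (u p.1), ← (measurePreserving_comp_equiv ν e).lintegral_comp hm]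
    refine lintegral_congr fun w => congrArg g (funext fun b => ?_)
    refine Fin.succAboveCases p.2 ?_ (fun j => ?_) b
    · rw [Overlap.pos_of_some _ (a := p.1) (by simp [Overlap.single]), Fin.insertNth_apply_same]
      rfl
    · rw [Overlap.pos_of_none _ (by simp [Overlap.single]), Fin.insertNth_apply_succAbove]
      rfl
  simp only [Sum.elim_inl]
  have h1 : ∀ u : Fin (m + 1) → S, ∫⁻ w : {b // (Overlap.single p).1 b = none} → S,
        f (fun a => u a) * g (fun b => (Sum.elim u w : _ → S) ((Overlap.single p).pos b))
          ∂(Measure.pi fun _ => ν) = f u * G (u p.1) := by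
    intro u
    rw [lintegral_const_mul, hinner]
    refine hg.comp (measurable_pi_lambda _ fun b => ?_)
    rcases (Overlap.single p).pos b with a | b'
    · exact measurable_const
    · exact measurable_pi_apply b'
  simp_rw [h1]
  rw [lintegral_pi_insertNth ν p.1 (by fun_prop)]
  refine lintegral_congr fun y => ?_
  simp only [Fin.insertNth_apply_same]
  rw [lintegral_mul_const, hF]
  exact hf.comp ((MeasurableEquiv.piFinSuccAbove (fun _ => S) p.1).symm.measurable.comp
    measurable_prodMk_left)

/-- The integral of a product over tuples without common entries. -/
theorem lintegral_overlap_empty {α β : Type*} [Fintype α] [Fintype β] (ν : Measure S)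
    [SigmaFinite ν] {f : (α → S) → ℝ≥0∞} {g : (β → S) → ℝ≥0∞} (hf : Measurable f)
    (hg : Measurable g) :
    ∫⁻ x, f (fun a => x (Sum.inl a)) * g (fun b => x ((Overlap.empty : Overlap α β).pos b))
        ∂(Measure.pi fun _ : (Overlap.empty : Overlap α β).Index => ν)
      = (∫⁻ x, f x ∂(Measure.pi fun _ => ν)) * ∫⁻ x, g x ∂(Measure.pi fun _ => ν) := by
  rw [lintegral_pi_sum ν (by fun_prop)]
  let e : β ≃ {b // (Overlap.empty : Overlap α β).1 b = none} :=
    (Equiv.subtypeUnivEquiv fun _ => rfl).symm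
  have h1 : ∀ u : α → S, ∫⁻ w : {b // (Overlap.empty : Overlap α β).1 b = none} → S,
        f (fun a => (Sum.elim u w : _ → S) (Sum.inl a)) *
          g (fun b => (Sum.elim u w : _ → S) ((Overlap.empty : Overlap α β).pos b))
          ∂(Measure.pi fun _ => ν) = f u * ∫⁻ x, g x ∂(Measure.pi fun _ => ν) := by
    intro u
    rw [← (measurePreserving_comp_equiv ν e).lintegral_comp hg, ← lintegral_const_mul]
    · refine lintegral_congr fun w => ?_
      refine congrArg₂ _ rfl (congrArg g (funext fun b => ?_))
      rw [Overlap.pos_of_none _ (by simp [Overlap.empty])]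
      rfl
    · fun_prop
  simp_rw [h1]
  rw [lintegral_mul_const _ hf]

end PiIntegrals

/-! ### Uniform directions on the sphere and on the hemisphere. -/

section Directions

variable {d : ℕ}

/-- The surface measure of the unit sphere. -/
abbrev surf (d : ℕ) : Measure (Sph d) := (volume : Measure (E d)).toSphere

/-- The action of a linear isometry on the unit sphere. -/
def sphMap (g : E d ≃ₗᵢ[ℝ] E d) (v : Sph d) : Sph d :=
  ⟨g v, by simp⟩

@[simp]
theorem coe_sphMap (g : E d ≃ₗᵢ[ℝ] E d) (v : Sph d) : (sphMap g v : E d) = g v := rfl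

theorem measurable_sphMap (g : E d ≃ₗᵢ[ℝ] E d) : Measurable (sphMap g) :=
  (g.continuous.measurable.comp measurable_subtype_coe).subtype_mk

open scoped Pointwise in
theorem measurePreserving_sphMap (g : E d ≃ₗᵢ[ℝ] E d) :
    MeasurePreserving (sphMap g) (surf d) (surf d) := by
  refine ⟨measurable_sphMap g, Measure.ext fun s hs => ?_⟩
  rw [Measure.map_apply (measurable_sphMap g) hs, Measure.toSphere_apply' _ hs,
    Measure.toSphere_apply' _ (measurable_sphMap g hs)]
  congr 1
  have h1 : Set.Ioo (0 : ℝ) 1 • ((↑) '' (sphMap g ⁻¹' s) : Set (E d))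
      = g ⁻¹' (Set.Ioo (0 : ℝ) 1 • ((↑) '' s)) := by
    ext x
    simp only [Set.mem_preimage, Set.mem_smul, Set.mem_image]
    constructor
    · rintro ⟨t, ht, _, ⟨v, hv, rfl⟩, rfl⟩
      exact ⟨t, ht, g v, ⟨_, hv, rfl⟩, by simp⟩
    · rintro ⟨t, ht, _, ⟨v, hv, rfl⟩, hx⟩
      refine ⟨t, ht, g.symm v, ⟨sphMap g.symm v, ?_, rfl⟩, ?_⟩
      · have : sphMap g (sphMap g.symm v) = v := Subtype.ext (by simp)
        rwa [this]
      · apply g.injective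
        rw [← hx]
        simp
  rw [h1]
  exact g.measurePreserving.measure_preimage_equiv (f := g.toMeasurableEquiv) _

-- Surface measure is the volume of the cone over a set, and here the cone lies in a proper
-- subspace.
open scoped Pointwise in
theorem surf_submodule (W : Submodule ℝ (E d)) (hW : W ≠ ⊤) :
    surf d {v : Sph d | (v : E d) ∈ W} = 0 := by
  have hm : MeasurableSet {v : Sph d | (v : E d) ∈ W} :=
    measurable_subtype_coe W.closed_of_finiteDimensional.measurableSet
  rw [Measure.toSphere_apply' _ hm]
  refine mul_eq_zero_of_right _ (measure_mono_null ?_ (Measure.addHaar_submodule volume W hW))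
  rintro _ ⟨t, _, _, ⟨v, hv, rfl⟩, rfl⟩
  exact W.smul_mem t hv

theorem measurableSet_upperSph : MeasurableSet (upperSph d) := by
  have : upperSph d = ⋂ i : Fin d, ⋂ _ : (i : ℕ) + 1 = d, {v : Sph d | 0 ≤ (v : E d) i} := by
    ext v
    simp [upperSph]
  rw [this]
  refine MeasurableSet.iInter fun i => MeasurableSet.iInter fun _ => ?_
  exact measurableSet_le measurable_const (by fun_prop)

/-- The antipodal map of the sphere. -/
abbrev antipode : Sph d → Sph d := sphMap (LinearIsometryEquiv.neg ℝ)

/-- The two sets differ only on the equator, where the last coordinate vanishes; it is a null set.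
-/
theorem antipode_preimage_compl_upperSph (hd : 1 ≤ d) :
    antipode ⁻¹' (upperSph d)ᶜ =ᵐ[surf d] upperSph d := by
  let i : Fin d := ⟨d - 1, by omega⟩
  have hi : (i : ℕ) + 1 = d := by simp only [i]; omega
  have hup : ∀ v : Sph d, v ∈ upperSph d ↔ 0 ≤ (v : E d) i := by
    intro v
    refine ⟨fun h => h i hi, fun h j hj => ?_⟩
    have : j = i := Fin.ext (by omega)
    rwa [this]
  let W : Submodule ℝ (E d) := LinearMap.ker (EuclideanSpace.proj i : E d →L[ℝ] ℝ).toLinearMap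
  have hW : W ≠ ⊤ := by
    intro h
    have h1 : EuclideanSpace.single i (1 : ℝ) ∈ W := h ▸ Submodule.mem_top
    simp [W] at h1
  have h0 : ∀ᵐ v : Sph d ∂(surf d), (v : E d) ∉ W := by
    rw [ae_iff]
    simpa using surf_submodule W hW
  filter_upwards [h0] with v hv
  apply propext
  have hv0 : (v : E d) i ≠ 0 := by simpa [W] using hv
  change ¬ (antipode v ∈ upperSph d) ↔ v ∈ upperSph d
  rw [hup, hup]
  simp only [coe_sphMap, LinearIsometryEquiv.coe_neg, PiLp.neg_apply, Left.nonneg_neg_iff, not_le]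
  exact ⟨le_of_lt, fun h => lt_of_le_of_ne h hv0.symm⟩

/-- Replaces a unit vector by its antipode if it is not in the upper hemisphere. -/
def toUpper (v : Sph d) : Sph d :=
  open Classical in if v ∈ upperSph d then v else antipode v

theorem measurable_toUpper : Measurable (toUpper (d := d)) :=
  Measurable.ite measurableSet_upperSph measurable_id (measurable_sphMap _)

theorem surf_toUpper_preimage (hd : 1 ≤ d) {A : Set (Sph d)} (hA : MeasurableSet A) :
    surf d (toUpper ⁻¹' A) = 2 * surf d (upperSph d ∩ A) := by
  have h1 : toUpper ⁻¹' A = (upperSph d ∩ A) ∪ ((upperSph d)ᶜ ∩ antipode ⁻¹' A) := by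
    ext v
    by_cases hv : v ∈ upperSph d <;> simp [toUpper, hv]
  have h2 : (upperSph d)ᶜ ∩ antipode ⁻¹' A = antipode ⁻¹' (antipode ⁻¹' (upperSph d)ᶜ ∩ A) := by
    rw [Set.preimage_inter, ← Set.preimage_comp (s := (upperSph d)ᶜ)]
    have : (antipode ∘ antipode : Sph d → Sph d) = id := by
      funext v
      exact Subtype.ext (by simp)
    rw [this, Set.preimage_id]
  have h3 : surf d ((upperSph d)ᶜ ∩ antipode ⁻¹' A) = surf d (upperSph d ∩ A) := by
    rw [h2, (measurePreserving_sphMap _).measure_preimage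
      (((measurable_sphMap _ measurableSet_upperSph.compl).inter hA).nullMeasurableSet)]
    exact measure_congr ((antipode_preimage_compl_upperSph hd).inter (ae_eq_refl A))
  rw [h1, measure_union _ (measurableSet_upperSph.compl.inter (measurable_sphMap _ hA)), h3, two_mul]
  exact Set.disjoint_left.2 fun v hv hv' => hv'.1 hv.1

theorem surf_univ_ne_zero (hd : 1 ≤ d) : surf d Set.univ ≠ 0 := by
  have : Nontrivial (E d) := by
    have : Nonempty (Fin d) := ⟨⟨0, hd⟩⟩
    infer_instance
  exact fun h => Measure.toSphere_ne_zero (volume : Measure (E d)) (Measure.measure_univ_eq_zero.1 h)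

theorem surf_univ_eq (hd : 1 ≤ d) : surf d Set.univ = 2 * surf d (upperSph d) := by
  simpa using surf_toUpper_preimage hd MeasurableSet.univ

theorem surf_upperSph_ne_zero (hd : 1 ≤ d) : surf d (upperSph d) ≠ 0 := fun h =>
  surf_univ_ne_zero hd (by rw [surf_univ_eq hd, h, mul_zero])

theorem isProbabilityMeasure_unifDir (hd : 1 ≤ d) : IsProbabilityMeasure (unifDir d) :=
  cond_isProbabilityMeasure (surf_upperSph_ne_zero hd)

instance : IsFiniteMeasure (unifDir d) := by
  unfold unifDir
  infer_instance

/-- The uniform distribution on the unit sphere. -/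
def fullDir (d : ℕ) : Measure (Sph d) := (surf d Set.univ)⁻¹ • surf d

theorem isProbabilityMeasure_fullDir (hd : 1 ≤ d) : IsProbabilityMeasure (fullDir d) :=
  ⟨ENNReal.inv_mul_cancel (surf_univ_ne_zero hd) (measure_ne_top (surf d) _)⟩

theorem measurePreserving_sphMap_fullDir (g : E d ≃ₗᵢ[ℝ] E d) :
    MeasurePreserving (sphMap g) (fullDir d) (fullDir d) :=
  (measurePreserving_sphMap g).smul_measure _

/-- Rotations do not preserve the hemisphere. This links the hemispherical law to the rotation
invariant law on the whole sphere. -/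
theorem measurePreserving_toUpper (hd : 1 ≤ d) :
    MeasurePreserving toUpper (fullDir d) (unifDir d) := by
  refine ⟨measurable_toUpper, Measure.ext fun A hA => ?_⟩
  rw [Measure.map_apply measurable_toUpper hA, fullDir, Measure.smul_apply,
    surf_toUpper_preimage hd hA, unifDir, cond_apply measurableSet_upperSph, smul_eq_mul,
    surf_univ_eq hd, ENNReal.mul_inv (by simp) (by simp), ← mul_assoc, mul_right_comm _ _ (2 : ℝ≥0∞),
    ENNReal.inv_mul_cancel (by simp) (by simp), one_mul]

theorem unifDir_submodule (W : Submodule ℝ (E d)) (hW : W ≠ ⊤) :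
    unifDir d {v : Sph d | (v : E d) ∈ W} = 0 :=
  cond_absolutelyContinuous (surf_submodule W hW)

end Directions

/-! ### The hyperplane measure under translation, scaling and rotation; general position. -/

section ParamMeasures

variable {d : ℕ}

/-- The motion invariant measure on hyperplane parameters. -/
def flatMeasure (d : ℕ) : Measure (Param d) := (volume : Measure ℝ).prod (unifDir d)

/-- The motion invariant measure on hyperplane parameters with normals in the full sphere. -/
def fullMeasure (d : ℕ) : Measure (Param d) := (volume : Measure ℝ).prod (fullDir d)

instance : SigmaFinite (flatMeasure d) := by
  unfold flatMeasure
  infer_instance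

theorem flatMeasure_apply {s : Set (Param d)} (hs : MeasurableSet s) :
    flatMeasure d s = ∫⁻ v, volume ((fun p : ℝ => (p, v)) ⁻¹' s) ∂(unifDir d) :=
  Measure.prod_apply_symm hs

/-- The parameter of the same hyperplane with normal vector in the upper hemisphere. -/
def normalize (y : Param d) : Param d :=
  open Classical in if y.2 ∈ upperSph d then y else (-y.1, antipode y.2)

theorem H_normalize (y : Param d) : H (normalize y) = H y := by
  unfold normalize
  split_ifs
  · rfl
  · ext x
    simp [H]

theorem measurable_normalize : Measurable (normalize (d := d)) :=
  Measurable.ite (measurable_snd measurableSet_upperSph) measurable_id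
    ((measurable_neg.comp measurable_fst).prodMk ((measurable_sphMap _).comp measurable_snd))

/-- For `v` outside the upper hemisphere the map reflects `p`, which preserves Lebesgue measure; in
the `v` variable it acts as `toUpper`. -/
theorem measurePreserving_normalize (hd : 1 ≤ d) :
    MeasurePreserving normalize (fullMeasure d) (flatMeasure d) := by
  classical
  have := isProbabilityMeasure_fullDir hd
  refine ⟨measurable_normalize, Measure.ext fun s hs => ?_⟩
  rw [Measure.map_apply measurable_normalize hs, flatMeasure_apply hs, fullMeasure,
    Measure.prod_apply_symm (measurable_normalize hs),
    ← (measurePreserving_toUpper hd).lintegral_comp (measurable_measure_prodMk_right hs)]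
  refine lintegral_congr fun v => ?_
  by_cases hv : v ∈ upperSph d
  · congr 1
    ext p
    simp [normalize, toUpper, hv]
  · rw [← Measure.measure_preimage_neg]
    congr 1
    ext p
    simp [normalize, toUpper, hv]

/-- The action of a rotation on hyperplane parameters. -/
def rotate (g : E d ≃ₗᵢ[ℝ] E d) (y : Param d) : Param d := (y.1, sphMap g y.2)

theorem measurePreserving_rotate (hd : 1 ≤ d) (g : E d ≃ₗᵢ[ℝ] E d) :
    MeasurePreserving (rotate g) (fullMeasure d) (fullMeasure d) :=
  have := isProbabilityMeasure_fullDir hd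
  (MeasurePreserving.id _).prod (measurePreserving_sphMap_fullDir g)

theorem H_rotate (g : E d ≃ₗᵢ[ℝ] E d) (y : Param d) : H (rotate g y) = g.symm ⁻¹' H y := by
  ext x
  simp only [H, rotate, coe_sphMap, Set.mem_preimage]
  change inner ℝ x (g y.2) = y.1 ↔ inner ℝ (g.symm x) (y.2 : E d) = y.1
  rw [← g.inner_map_map (g.symm x), g.apply_symm_apply]

/-- Translation by `-c` followed by scaling by `t⁻¹`, on hyperplane parameters. -/
def shiftScale (c : E d) (t : ℝ) (y : Param d) : Param d :=
  ((y.1 - inner ℝ c (y.2 : E d)) / t, y.2)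

theorem measurable_shiftScale (c : E d) (t : ℝ) : Measurable (shiftScale c t) := by
  unfold shiftScale
  fun_prop

/-- For fixed `v` the map in `p` is a translation followed by division by `t`. On hyperplanes it is
`H ↦ t⁻¹(H - c)`. -/
theorem map_shiftScale (c : E d) {t : ℝ} (ht : 0 < t) :
    (flatMeasure d).map (shiftScale c t) = ENNReal.ofReal t • flatMeasure d := by
  refine Measure.ext fun s hs => ?_
  rw [Measure.map_apply (measurable_shiftScale c t) hs, Measure.smul_apply, flatMeasure_apply hs,
    flatMeasure_apply (measurable_shiftScale c t hs), smul_eq_mul,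
    ← lintegral_const_mul _ (measurable_measure_prodMk_right hs)]
  refine lintegral_congr fun v => ?_
  have h1 : (fun p : ℝ => (p, v)) ⁻¹' (shiftScale c t ⁻¹' s)
      = (fun p => p + -inner ℝ c (v : E d)) ⁻¹' ((fun p => p * t⁻¹) ⁻¹' ((fun p : ℝ => (p, v)) ⁻¹' s)) := by
    ext p
    simp [shiftScale, div_eq_mul_inv, sub_eq_add_neg]
  rw [h1, measure_preimage_add_right, Real.volume_preimage_mul_right (by positivity), inv_inv,
    abs_of_pos ht]

/-- The set of parameters of hyperplanes at distance at most `r` from the origin. -/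
def box (d : ℕ) (r : ℝ) : Set (Param d) := Set.Icc (-r) r ×ˢ Set.univ

theorem measurableSet_box (r : ℝ) : MeasurableSet (box d r) :=
  measurableSet_Icc.prod MeasurableSet.univ

theorem isProbabilityMeasure_paramLaw (hd : 1 ≤ d) {r : ℝ} (hr : 0 < r) :
    IsProbabilityMeasure (paramLaw d r) := by
  have := isProbabilityMeasure_unifDir hd
  have : IsProbabilityMeasure (ProbabilityTheory.cond (volume : Measure ℝ) (Set.Icc (-r) r)) :=
    cond_isProbabilityMeasure_of_finite (by simp; linarith) (by simp)
  unfold paramLaw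
  infer_instance

theorem flatMeasure_restrict_box {r : ℝ} (hr : 0 < r) :
    (flatMeasure d).restrict (box d r) = ENNReal.ofReal (2 * r) • paramLaw d r := by
  have h2 : (volume : Measure ℝ) (Set.Icc (-r) r) = ENNReal.ofReal (2 * r) := by
    rw [Real.volume_Icc]
    congr 1
    ring
  rw [paramLaw, ProbabilityTheory.cond, h2, Measure.prod_smul_left, smul_smul,
    ENNReal.mul_inv_cancel (by simpa using hr) ENNReal.ofReal_ne_top, one_smul, flatMeasure, box,
    ← Measure.prod_restrict, Measure.restrict_univ]

theorem ae_paramLaw_abs_lt (r : ℝ) : ∀ᵐ y ∂(paramLaw d r), |y.1| < r := by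
  have h1 : ∀ᵐ p ∂((volume : Measure ℝ).restrict (Set.Icc (-r) r)), |p| < r := by
    rw [← restrict_Ioo_eq_restrict_Icc]
    filter_upwards [ae_restrict_mem measurableSet_Ioo] with p hp
    exact abs_lt.2 hp
  have h2 : ∀ᵐ p ∂(ProbabilityTheory.cond (volume : Measure ℝ) (Set.Icc (-r) r)), |p| < r :=
    Measure.smul_absolutelyContinuous.ae_le h1
  have : SFinite (ProbabilityTheory.cond (volume : Measure ℝ) (Set.Icc (-r) r)) := by
    unfold ProbabilityTheory.cond
    infer_instance
  exact Measure.quasiMeasurePreserving_fst.ae h2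

theorem lintegral_pi_paramLaw {ι : Type*} [Fintype ι] (hd : 1 ≤ d) {r : ℝ} (hr : 0 < r)
    {f : (ι → Param d) → ℝ≥0∞} (hf : ∀ x, f x ≠ 0 → ∀ j, x j ∈ box d r) :
    ∫⁻ x, f x ∂(Measure.pi fun _ => flatMeasure d)
      = ENNReal.ofReal (2 * r) ^ Fintype.card ι * ∫⁻ x, f x ∂(Measure.pi fun _ => paramLaw d r) := by
  have := isProbabilityMeasure_paramLaw hd hr
  rw [← smul_eq_mul, ← lintegral_smul_measure, ← pi_const_smul _ ENNReal.ofReal_ne_top, ← flatMeasure_restrict_box hr,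
    ← Measure.restrict_pi_pi, setLIntegral_eq_of_support_subset]
  intro x hx j _
  exact hf x hx j

theorem lintegral_pi_shiftScale {ι : Type*} [Fintype ι] (c : E d) {t : ℝ} (ht : 0 < t)
    {f : (ι → Param d) → ℝ≥0∞} (hf : Measurable f) :
    ∫⁻ x, f (fun j => shiftScale c t (x j)) ∂(Measure.pi fun _ => flatMeasure d)
      = ENNReal.ofReal t ^ Fintype.card ι * ∫⁻ x, f x ∂(Measure.pi fun _ => flatMeasure d) := by
  have hs : SigmaFinite (ENNReal.ofReal t • flatMeasure d) :=
    inferInstanceAs (SigmaFinite (t.toNNReal • flatMeasure d))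
  have : SigmaFinite ((flatMeasure d).map (shiftScale c t)) := by
    rw [map_shiftScale c ht]
    exact hs
  rw [← smul_eq_mul, ← lintegral_smul_measure, ← pi_const_smul _ (by simp), ← map_shiftScale c ht,
    ← Measure.pi_map_pi fun _ => (measurable_shiftScale c t).aemeasurable, lintegral_map hf]
  exact measurable_pi_lambda _ fun j => (measurable_shiftScale c t).comp (measurable_pi_apply j)

/-- Since `f` sees only the hyperplanes, the integral lifts along `normalize` to `fullMeasure`,
which is rotation invariant. -/
theorem lintegral_pi_rotate {ι : Type*} [Fintype ι] (hd : 1 ≤ d) (g : E d ≃ₗᵢ[ℝ] E d)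
    {f : (ι → Param d) → ℝ≥0∞} (hf : Measurable f)
    (hn : ∀ x x', (∀ j, H (x j) = H (x' j)) → f x = f x') :
    ∫⁻ x, f (fun j => rotate g (x j)) ∂(Measure.pi fun _ => flatMeasure d)
      = ∫⁻ x, f x ∂(Measure.pi fun _ => flatMeasure d) := by
  have := isProbabilityMeasure_fullDir hd
  have hsf : SigmaFinite (fullMeasure d) := by
    unfold fullMeasure
    infer_instance
  have hN := measurePreserving_pi (fun _ : ι => fullMeasure d) (fun _ => flatMeasure d)
    fun _ => measurePreserving_normalize hd
  have hR := measurePreserving_pi (fun _ : ι => fullMeasure d) (fun _ => fullMeasure d)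
    fun _ => measurePreserving_rotate hd g
  have hRm : Measurable fun (x : ι → Param d) j => rotate g (x j) :=
    measurable_pi_lambda _ fun j => (measurePreserving_rotate hd g).measurable.comp
      (measurable_pi_apply j)
  rw [← hN.lintegral_comp (f := fun x => f fun j => rotate g (x j)) (hf.comp hRm),
    ← hN.lintegral_comp hf, ← hR.lintegral_comp (f := fun x => f fun j => normalize (x j)) (hf.comp hN.measurable)]
  refine lintegral_congr fun x => hn _ _ fun j => ?_
  rw [H_rotate, H_normalize, H_normalize, H_rotate]

/-- Almost all tuples of at most `d` normal vectors are linearly independent. -/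
theorem ae_linearIndependent {m : ℕ} (hm : m ≤ d) :
    ∀ᵐ x ∂(Measure.pi fun _ : Fin m => flatMeasure d),
      LinearIndependent ℝ fun j => ((x j).2 : E d) := by
  have hmeas : ∀ n, MeasurableSet {x : Fin n → Param d |
      LinearIndependent ℝ fun j => ((x j).2 : E d)} := by
    intro n
    have h1 : IsOpen {f : Fin n → E d | LinearIndependent ℝ f} := isOpen_setOfPred_linearIndependent
    have h2 : Measurable fun (x : Fin n → Param d) j => ((x j).2 : E d) := by fun_prop
    exact h2 h1.measurableSet
  induction m with
  | zero => exact ae_of_all _ fun x => linearIndependent_empty_type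
  | succ m ih =>
    have h := (measurePreserving_piFinSuccAbove (fun _ : Fin (m + 1) => flatMeasure d) 0).symm
    rw [ae_iff]
    change Measure.pi (fun _ : Fin (m + 1) => flatMeasure d) {x : Fin (m + 1) → Param d |
      LinearIndependent ℝ fun j => ((x j).2 : E d)}ᶜ = 0
    rw [← h.measure_preimage (hmeas _).compl.nullMeasurableSet,
      Measure.prod_apply_symm (h.measurable (hmeas _).compl),
      lintegral_eq_zero_iff (measurable_measure_prodMk_right (h.measurable (hmeas _).compl))]
    filter_upwards [ih (by omega)] with u hu
    -- Fewer than `d` normals span a proper subspace, which the next normal almost surely avoids.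
    let W := Submodule.span ℝ (Set.range fun j => ((u j).2 : E d))
    have hW : W ≠ ⊤ := by
      intro htop
      have h1 : Module.finrank ℝ W ≤ m := by
        simpa [Set.finrank] using finrank_range_le_card (R := ℝ) fun j => ((u j).2 : E d)
      rw [htop, finrank_top, finrank_euclideanSpace, Fintype.card_fin] at h1
      omega
    have h2 : flatMeasure d {y : Param d | (y.2 : E d) ∈ W} = 0 := by
      have : {y : Param d | (y.2 : E d) ∈ W} = Set.univ ×ˢ {v : Sph d | (v : E d) ∈ W} := by
        ext; simp
      rw [this, flatMeasure, Measure.prod_prod, unifDir_submodule W hW, mul_zero]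
    refine measure_mono_null (fun y hy => ?_) h2
    by_contra hyW
    refine hy ?_
    have h3 : (fun j => ((((MeasurableEquiv.piFinSuccAbove (fun _ => Param d) (0 : Fin (m + 1))).symm
        (y, u)) j).2 : E d)) = Fin.cons (y.2 : E d) fun j => ((u j).2 : E d) := by
      funext j
      refine Fin.cases ?_ (fun i => ?_) j <;> rfl
    change LinearIndependent ℝ _
    rw [h3, linearIndependent_finCons]
    exact ⟨hu, hyW⟩

end ParamMeasures

/-! ### The profile `capSup`, common to hitting indicators and section volumes. -/

section Cap

variable {d : ℕ}

/-- The profile `(1 - t²)^(a/2)` on `[0, 1]`, extended by zero. -/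
def cap (a : ℕ) (t : ℝ) : ℝ≥0∞ :=
  if t ≤ 1 then ENNReal.ofReal (√(1 - t ^ 2) ^ a) else 0

theorem cap_le_one (a : ℕ) (t : ℝ) : cap a t ≤ 1 := by
  unfold cap
  split_ifs
  · rw [ENNReal.ofReal_le_one]
    exact pow_le_one₀ (Real.sqrt_nonneg _) (Real.sqrt_le_one.2 (by nlinarith [sq_nonneg t]))
  · exact zero_le

theorem cap_anti (a : ℕ) {s t : ℝ} (hs : 0 ≤ s) (hst : s ≤ t) : cap a t ≤ cap a s := by
  unfold cap
  split_ifs with h1 h2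
  · refine ENNReal.ofReal_le_ofReal (pow_le_pow_left₀ (Real.sqrt_nonneg _) (Real.sqrt_le_sqrt ?_) a)
    nlinarith
  · exact absurd (hst.trans h1) h2
  · exact zero_le
  · exact le_rfl

theorem cap_pos (a : ℕ) {t : ℝ} (h0 : 0 ≤ t) (h1 : t < 1) : 0 < cap a t := by
  unfold cap
  rw [if_pos h1.le, ENNReal.ofReal_pos]
  exact pow_pos (Real.sqrt_pos.2 (by nlinarith)) a

/-- The supremum over `z ∈ K` of `(1 - |z|²/r²)^(a/2)`; for a flat `K` of dimension `a` this is the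
normalized volume of `K ∩ B_r`, and for `a = 0` it indicates whether `K` hits `B_r`. -/
def capSup (a : ℕ) (r : ℝ) (K : Set (E d)) : ℝ≥0∞ := ⨆ z ∈ K, cap a (‖z‖ / r)

theorem capSup_le_one (a : ℕ) (r : ℝ) (K : Set (E d)) : capSup a r K ≤ 1 :=
  iSup₂_le fun _ _ => cap_le_one _ _

/-- For `a = 0` the power is identically one, so only the cutoff `t ≤ 1` in `cap` sees the ball;
points on its boundary count. -/
theorem chi_inter_ball {r : ℝ} (hr : 0 < r) (K : Set (E d)) : chi (K ∩ ball d r) = capSup 0 r K := by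
  unfold chi
  split_ifs with h
  · obtain ⟨z, hz, hzr⟩ := h
    refine le_antisymm ?_ (capSup_le_one _ _ _)
    refine le_iSup₂_of_le z hz ?_
    have : ‖z‖ / r ≤ 1 := (div_le_one hr).2 (by simpa [ball] using hzr)
    simp [cap, this]
  · symm
    rw [capSup]
    simp only [ENNReal.iSup_eq_zero]
    intro z hz
    have : ¬ ‖z‖ / r ≤ 1 := fun hle => h ⟨z, hz, by simpa [ball] using (div_le_one hr).1 hle⟩
    simp [cap, this]

theorem isClosed_H (y : Param d) : IsClosed (H y) := by
  unfold H
  exact isClosed_eq (by fun_prop) continuous_const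

theorem capSup_eq_of_isMin {a : ℕ} {r : ℝ} (hr : 0 < r) {K : Set (E d)} {z : E d} (hz : z ∈ K)
    (hmin : ∀ w ∈ K, ‖z‖ ≤ ‖w‖) : capSup a r K = cap a (‖z‖ / r) := by
  refine le_antisymm (iSup₂_le fun w hw => cap_anti a (by positivity) ?_)
    (le_iSup₂_of_le z hz le_rfl)
  have := hmin w hw
  gcongr

/-- A nonempty closed set has a point nearest to the origin, and `cap` decreases with distance, so
the supremum is attained. -/
theorem le_capSup_iff {a : ℕ} {r : ℝ} (hr : 0 < r) {K : Set (E d)} (hK : IsClosed K) {c : ℝ≥0∞}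
    (hc : c ≠ 0) : c ≤ capSup a r K ↔ ∃ z ∈ K, c ≤ cap a (‖z‖ / r) := by
  constructor
  · intro h
    rcases K.eq_empty_or_nonempty with rfl | hne
    · simp [capSup, hc] at h
    · obtain ⟨z, hz, hmin⟩ := hK.exists_infDist_eq_dist hne 0
      refine ⟨z, hz, ?_⟩
      rwa [← capSup_eq_of_isMin hr hz]
      intro w hw
      have := Metric.infDist_le_dist_of_mem (x := (0 : E d)) hw
      rw [hmin] at this
      simpa using this
  · rintro ⟨z, hz, h⟩
    exact le_iSup₂_of_le z hz h

/-- Superlevel sets are projections of closed sets along the compact ball, hence closed. No general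
position is needed. -/
theorem measurable_capSup_flat {ι : Type*} [Finite ι] (a : ℕ) {r : ℝ} (hr : 0 < r) :
    Measurable fun x : ι → Param d => capSup a r (⋂ j, H (x j)) := by
  have := Fintype.ofFinite ι
  refine measurable_of_Ici fun c => ?_
  rcases eq_or_ne c 0 with rfl | hc
  · simp
  have hcl : IsClosed ((fun x : ι → Param d => capSup a r (⋂ j, H (x j))) ⁻¹' Set.Ici c) := by
    let C : Set ((ι → Param d) × Metric.closedBall (0 : E d) r) :=
      {q | (∀ j, inner ℝ (q.2 : E d) ((q.1 j).2 : E d) = (q.1 j).1) ∧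
        c ≤ ENNReal.ofReal (√(1 - (‖(q.2 : E d)‖ / r) ^ 2) ^ a)}
    have hC : IsClosed C := by
      have h1 : C = (⋂ j, {q | inner ℝ (q.2 : E d) ((q.1 j).2 : E d) = (q.1 j).1}) ∩
          {q | c ≤ ENNReal.ofReal (√(1 - (‖(q.2 : E d)‖ / r) ^ 2) ^ a)} := by
        ext q
        simp [C]
      rw [h1]
      refine (isClosed_iInter fun j => isClosed_eq (by fun_prop) (by fun_prop)).inter
        (isClosed_le continuous_const (ENNReal.continuous_ofReal.comp (by fun_prop)))
    have h2 : (fun x : ι → Param d => capSup a r (⋂ j, H (x j))) ⁻¹' Set.Ici c = Prod.fst '' C := by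
      ext x
      rw [Set.mem_preimage, Set.mem_Ici, le_capSup_iff hr (isClosed_iInter fun j => isClosed_H _) hc]
      constructor
      · rintro ⟨z, hz, hle⟩
        unfold cap at hle
        split_ifs at hle with h
        · refine ⟨(x, ⟨z, by simpa using (div_le_one hr).1 h⟩), ⟨fun j => ?_, hle⟩, rfl⟩
          exact Set.mem_iInter.1 hz j
        · exact absurd (le_antisymm hle (zero_le)) hc
      · rintro ⟨⟨x', z, hz⟩, ⟨h3, h4⟩, rfl⟩
        refine ⟨z, Set.mem_iInter.2 h3, ?_⟩
        unfold cap
        rwa [if_pos ((div_le_one hr).2 (by simpa using hz))]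
    have : CompactSpace (Metric.closedBall (0 : E d) r) :=
      isCompact_iff_compactSpace.1 (isCompact_closedBall _ _)
    rw [h2]
    exact isClosedMap_fst_of_compactSpace _ hC
  exact hcl.measurableSet

theorem mem_box_of_capSup_ne_zero {ι : Type*} {a : ℕ} {r : ℝ} (hr : 0 < r) {x : ι → Param d}
    (h : capSup a r (⋂ j, H (x j)) ≠ 0) (j : ι) : x j ∈ box d r := by
  have h1 : ∃ z ∈ ⋂ j, H (x j), cap a (‖z‖ / r) ≠ 0 := by
    by_contra hcon
    push Not at hcon
    refine h ?_
    rw [capSup]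
    simp only [ENNReal.iSup_eq_zero]
    exact hcon
  obtain ⟨z, hz, hzc⟩ := h1
  have h2 : ‖z‖ ≤ r := by
    by_contra hcon
    exact hzc (if_neg fun hle => hcon ((div_le_one hr).1 hle))
  have h3 : inner ℝ z ((x j).2 : E d) = (x j).1 := Set.mem_iInter.1 hz j
  have h4 : |(x j).1| ≤ r := by
    rw [← h3]
    refine (abs_real_inner_le_norm _ _).trans ?_
    simpa using h2
  exact ⟨abs_le.1 h4, trivial⟩

theorem iInter_H_insertNth {q : ℕ} (i : Fin (q + 1)) (y : Param d) (x : Fin q → Param d) :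
    ⋂ j, H (i.insertNth (α := fun _ => Param d) y x j) = (⋂ j, H (x j)) ∩ H y := by
  ext z
  simp only [Set.mem_iInter, Set.mem_inter_iff, Fin.forall_iff_succAbove i, Fin.insertNth_apply_same,
    Fin.insertNth_apply_succAbove]
  exact and_comm

theorem measurable_capSup_flat_inter {q : ℕ} (a : ℕ) {r : ℝ} (hr : 0 < r) (y : Param d) :
    Measurable fun x : Fin q → Param d => capSup a r ((⋂ j, H (x j)) ∩ H y) := by
  simp only [← iInter_H_insertNth 0]
  exact (measurable_capSup_flat a hr).comp
    ((MeasurableEquiv.piFinSuccAbove (fun _ => Param d) 0).symm.measurable.comp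
      measurable_prodMk_left)

theorem capSup_preimage_isometry (a : ℕ) (r : ℝ) (g : E d ≃ₗᵢ[ℝ] E d) (K : Set (E d)) :
    capSup a r (g ⁻¹' K) = capSup a r K := by
  unfold capSup
  refine le_antisymm (iSup₂_le fun z hz => le_iSup₂_of_le (g z) hz (by simp)) ?_
  exact iSup₂_le fun z hz => le_iSup₂_of_le (g.symm z) (by simpa using hz) (by simp)

/-- Sections of a ball by the hyperplane `H y`, reduced to sections of the unit ball by a hyperplane
through the origin. -/
theorem capSup_inter_H {q : ℕ} (a : ℕ) {r : ℝ} (hr : 0 < r) {y : Param d} (hy : |y.1| < r)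
    (x : Fin q → Param d) :
    capSup a r ((⋂ j, H (x j)) ∩ H y) = ENNReal.ofReal (√(1 - (y.1 / r) ^ 2) ^ a) *
      capSup a 1 ((⋂ j, H (shiftScale (y.1 • (y.2 : E d)) (√(1 - (y.1 / r) ^ 2) * r) (x j)))
        ∩ H ((0 : ℝ), y.2)) := by
  obtain ⟨p, v⟩ := y
  simp only at hy ⊢
  have hpr : (p / r) ^ 2 < 1 := by
    rw [sq_lt_one_iff_abs_lt_one, abs_div, abs_of_pos hr, div_lt_one hr]
    exact hy
  -- `s r` is the radius of the section of `B_r` by `H (p, v)`, whose centre is `p • v`.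
  set s := √(1 - (p / r) ^ 2) with hs
  have hs0 : 0 < s := Real.sqrt_pos.2 (by linarith)
  have hs2 : s ^ 2 = 1 - (p / r) ^ 2 := Real.sq_sqrt (by linarith)
  have hsr : 0 < s * r := by positivity
  have hv : ‖(v : E d)‖ = 1 := by simp
  let K' := (⋂ j, H (shiftScale (p • (v : E d)) (s * r) (x j))) ∩ H ((0 : ℝ), v)
  have himg : (⋂ j, H (x j)) ∩ H (p, v) = (fun w => p • (v : E d) + (s * r) • w) '' K' := by
    have h1 : ∀ w : E d, w ∈ K' ↔ p • (v : E d) + (s * r) • w ∈ (⋂ j, H (x j)) ∩ H (p, v) := by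
      intro w
      simp only [K', Set.mem_inter_iff, Set.mem_iInter]
      refine and_congr (forall_congr' fun j => ?_) ?_
      · change inner ℝ w ((x j).2 : E d) = ((x j).1 - _) / (s * r) ↔
          inner ℝ (p • (v : E d) + (s * r) • w) ((x j).2 : E d) = (x j).1
        rw [eq_div_iff hsr.ne', inner_add_left, inner_smul_left (𝕜 := ℝ) w]
        simp only [conj_trivial]
        constructor <;> intro h <;> linarith
      · change inner ℝ w (v : E d) = 0 ↔ inner ℝ (p • (v : E d) + (s * r) • w) (v : E d) = p
        rw [inner_add_left, inner_smul_left, inner_smul_left, real_inner_self_eq_norm_sq, hv]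
        simp [hs0.ne', hr.ne']
    ext z
    constructor
    · intro hz
      refine ⟨(s * r)⁻¹ • (z - p • (v : E d)), (h1 _).2 ?_, ?_⟩ <;>
      · simp only [smul_smul, mul_inv_cancel₀ hsr.ne', one_smul]
        rw [add_sub_cancel]
        try exact hz
    · rintro ⟨w, hw, rfl⟩
      exact (h1 w).1 hw
  rw [himg, capSup, iSup_image, capSup]
  simp only [ENNReal.mul_iSup]
  refine iSup_congr fun w => iSup_congr fun hw => ?_
  have hwv : inner ℝ w (v : E d) = 0 := hw.2
  -- Pythagoras, as `w ⟂ v`. Subtracted from one this gives `s²(1 - ‖w‖²)`, so the profile factors.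
  have hn : (‖p • (v : E d) + (s * r) • w‖ / r) ^ 2 = (p / r) ^ 2 + s ^ 2 * ‖w‖ ^ 2 := by
    rw [div_pow, norm_add_sq_real, inner_smul_left, inner_smul_right, real_inner_comm, hwv,
      norm_smul, norm_smul, hv, Real.norm_eq_abs, Real.norm_eq_abs, abs_of_pos hsr]
    field_simp
    rw [sq_abs]
    ring
  have hle : ‖p • (v : E d) + (s * r) • w‖ / r ≤ 1 ↔ ‖w‖ ≤ 1 := by
    rw [← sq_le_one_iff₀ (by positivity), ← sq_le_one_iff₀ (norm_nonneg w), hn]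
    constructor
    · intro h
      by_contra hcon
      nlinarith [sq_pos_of_pos hs0]
    · intro h
      nlinarith [sq_pos_of_pos hs0]
  unfold cap
  simp only [hle, div_one]
  split_ifs
  · rw [← ENNReal.ofReal_mul (by positivity), ← mul_pow, hn]
    congr 2
    rw [show 1 - ((p / r) ^ 2 + s ^ 2 * ‖w‖ ^ 2) = s ^ 2 * (1 - ‖w‖ ^ 2) by rw [hs2]; ring,
      Real.sqrt_mul (sq_nonneg s), Real.sqrt_sq hs0.le]
  · simp

/-- Independent normals form a basis of their span, so inner products with them can be prescribed;
Riesz representation in the span gives `z`, the foot of the perpendicular from the origin. -/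
theorem flat_eq_add_orthogonal {ι : Type*} [Finite ι] {x : ι → Param d}
    (hx : LinearIndependent ℝ fun j => ((x j).2 : E d)) :
    ∃ z ∈ Submodule.span ℝ (Set.range fun j => ((x j).2 : E d)), ∀ w, w ∈ (⋂ j, H (x j)) ↔
      w - z ∈ (Submodule.span ℝ (Set.range fun j => ((x j).2 : E d)))ᗮ := by
  set U := Submodule.span ℝ (Set.range fun j => ((x j).2 : E d)) with hU
  let f : U →ₗ[ℝ] ℝ := (Module.Basis.span hx).constr ℝ fun j => (x j).1
  let z : U := (InnerProductSpace.toDual ℝ U).symm (LinearMap.toContinuousLinearMap f)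
  have hz : ∀ j, inner ℝ (z : E d) ((x j).2 : E d) = (x j).1 := by
    intro j
    have h1 : inner ℝ z (Module.Basis.span hx j) = f (Module.Basis.span hx j) := by
      simp [z]
    rw [Module.Basis.constr_basis, Submodule.coe_inner, Module.Basis.span_apply] at h1
    exact h1
  refine ⟨z, z.2, fun w => ?_⟩
  rw [Submodule.mem_orthogonal']
  constructor
  · intro hw u hu
    induction hu using Submodule.span_induction with
    | mem u hu =>
      obtain ⟨j, rfl⟩ := hu
      have : inner ℝ w ((x j).2 : E d) = (x j).1 := Set.mem_iInter.1 hw j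
      simp only [inner_sub_left, hz, this, sub_self]
    | zero => simp
    | add a b _ _ ha hb => rw [inner_add_right, ha, hb, add_zero]
    | smul c a _ ha => rw [inner_smul_right, ha, mul_zero]
  · intro h
    refine Set.mem_iInter.2 fun j => ?_
    have := h _ (Submodule.subset_span ⟨j, rfl⟩)
    rw [inner_sub_left, hz, sub_eq_zero] at this
    exact this

/-- The volume of the unit ball in `ℝ^k`. -/
def unitBallVol (k : ℕ) : ℝ≥0∞ := volume (Metric.ball (0 : E k) 1)

theorem unitBallVol_ne_zero (k : ℕ) : unitBallVol k ≠ 0 :=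
  (Metric.measure_ball_pos volume _ one_pos).ne'

theorem unitBallVol_ne_top (k : ℕ) : unitBallVol k ≠ ∞ :=
  measure_ball_lt_top.ne

/-- The volume of the intersection of a ball with a flat given by hyperplanes in general
position. -/
theorem nu_flat_inter_ball {m k : ℕ} (hmk : k + m = d) {r : ℝ} (hr : 0 < r) {x : Fin m → Param d}
    (hx : LinearIndependent ℝ fun j => ((x j).2 : E d)) :
    nu k ((⋂ j, H (x j)) ∩ ball d r)
      = unitBallVol k * ENNReal.ofReal (r ^ k) * capSup k r (⋂ j, H (x j)) := by
  obtain ⟨z, hzU, hz⟩ := flat_eq_add_orthogonal hx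
  set U := Submodule.span ℝ (Set.range fun j => ((x j).2 : E d)) with hU
  have hfin : Module.finrank ℝ Uᗮ = k := by
    have h1 := Submodule.finrank_add_finrank_orthogonal U
    have h2 : Module.finrank ℝ U = m := by
      rw [hU, finrank_span_eq_card hx, Fintype.card_fin]
    rw [h2, finrank_euclideanSpace, Fintype.card_fin] at h1
    omega
  have hnorm : ∀ w ∈ Uᗮ, ‖z + w‖ ^ 2 = ‖z‖ ^ 2 + ‖w‖ ^ 2 := by
    intro w hw
    rw [norm_add_sq_real, Submodule.inner_right_of_mem_orthogonal hzU hw]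
    ring
  have hmem : z ∈ ⋂ j, H (x j) := (hz z).2 (by simp)
  have hcap : capSup k r (⋂ j, H (x j)) = cap k (‖z‖ / r) := by
    refine capSup_eq_of_isMin hr hmem fun w hw => ?_
    have h1 := hnorm _ ((hz w).1 hw)
    rw [add_sub_cancel] at h1
    exact le_of_sq_le_sq (by nlinarith [sq_nonneg ‖w - z‖]) (norm_nonneg _)
  rw [hcap]
  unfold cap
  split_ifs with h
  -- An isometric chart of the flat centred at `z`, in which the section is the ball of radius `ρ =
  -- √(r² - ‖z‖²)`.
  · let b := (stdOrthonormalBasis ℝ Uᗮ).reindex (finCongr hfin)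
    let emb : E k → E d := fun u => z + (b.repr.symm u : Uᗮ)
    have hemb : Isometry emb :=
      (IsometryEquiv.addLeft z).isometry.comp
        (Uᗮ.subtypeₗᵢ.isometry.comp b.repr.symm.isometry)
    have hq : 0 ≤ 1 - (‖z‖ / r) ^ 2 := by
      have : 0 ≤ ‖z‖ / r := by positivity
      nlinarith
    set ρ := r * √(1 - (‖z‖ / r) ^ 2) with hρ
    have hρ0 : 0 ≤ ρ := by positivity
    have hρ2 : ρ ^ 2 = r ^ 2 - ‖z‖ ^ 2 := by
      rw [hρ, mul_pow, Real.sq_sqrt hq]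
      field_simp
    have himg : (⋂ j, H (x j)) ∩ ball d r = emb '' Metric.closedBall 0 ρ := by
      have hmemb : ∀ w ∈ Uᗮ, z + w ∈ ball d r ↔ ‖w‖ ≤ ρ := by
        intro w hw
        have h1 := hnorm w hw
        rw [ball, mem_closedBall_zero_iff]
        constructor
        · intro hle
          refine le_of_sq_le_sq ?_ hρ0
          rw [hρ2]
          nlinarith [norm_nonneg (z + w)]
        · intro hle
          refine le_of_sq_le_sq ?_ hr.le
          nlinarith [norm_nonneg w]
      ext w
      constructor
      · rintro ⟨hw, hwr⟩
        have h1 := (hz w).1 hw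
        refine ⟨b.repr ⟨w - z, h1⟩, ?_, by simp [emb]⟩
        rw [mem_closedBall_zero_iff, LinearIsometryEquiv.norm_map]
        exact (hmemb _ h1).1 (by rwa [add_sub_cancel])
      · rintro ⟨u, hu, rfl⟩
        refine ⟨(hz _).2 (by simp [emb]), (hmemb _ (Subtype.mem _)).2 ?_⟩
        change ‖b.repr.symm u‖ ≤ ρ
        rw [LinearIsometryEquiv.norm_map]
        exact mem_closedBall_zero_iff.1 hu
    rw [nu, himg, hemb.euclideanHausdorffMeasure_image]
    have hvol : (Measure.euclideanHausdorffMeasure k : Measure (E k)) = volume :=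
      EuclideanSpace.euclideanHausdorffMeasure_eq_volume k
    rw [hvol, Measure.addHaar_closedBall _ _ hρ0, finrank_euclideanSpace, Fintype.card_fin, hρ,
      mul_pow, ENNReal.ofReal_mul (by positivity), unitBallVol]
    ring
  · have hem : (⋂ j, H (x j)) ∩ ball d r = ∅ := by
      refine Set.eq_empty_of_forall_notMem fun w hw => h ((div_le_one hr).2 ?_)
      have h1 := hnorm _ ((hz w).1 hw.1)
      rw [add_sub_cancel] at h1
      have h2 : ‖w‖ ≤ r := by simpa [ball] using hw.2
      refine le_trans (le_of_sq_le_sq ?_ (norm_nonneg _)) h2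
      nlinarith [sq_nonneg ‖w - z‖]
    simp [nu, hem]

end Cap

/-! ### Conditional means given one hyperplane, and their radial form. -/

section SectionMean

variable {d : ℕ}

/-- The expectation of `capSup a r` of the intersection of `q` random hyperplanes with `H y`. -/
def sectionMean (a q : ℕ) (r : ℝ) (y : Param d) : ℝ≥0∞ :=
  ∫⁻ x : Fin q → Param d, capSup a r ((⋂ j, H (x j)) ∩ H y) ∂(Measure.pi fun _ => paramLaw d r)

theorem lintegral_capSup_insertNth (a q : ℕ) (r : ℝ) (i : Fin (q + 1)) (y : Param d) :
    ∫⁻ x : Fin q → Param d, capSup a r (⋂ j, H (i.insertNth (α := fun _ => Param d) y x j))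
      ∂(Measure.pi fun _ => paramLaw d r) = sectionMean a q r y := by
  simp only [iInter_H_insertNth]
  rfl

theorem sectionMean_le_one (hd : 1 ≤ d) (a q : ℕ) {r : ℝ} (hr : 0 < r) (y : Param d) :
    sectionMean a q r y ≤ 1 := by
  have := isProbabilityMeasure_paramLaw hd hr
  refine (lintegral_mono fun x => capSup_le_one _ _ _).trans ?_
  simp

theorem measurable_sectionMean (hd : 1 ≤ d) (a q : ℕ) {r : ℝ} (hr : 0 < r) :
    Measurable (sectionMean (d := d) a q r) := by
  have := isProbabilityMeasure_paramLaw hd hr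
  simpa only [lintegral_capSup_insertNth] using
    measurable_lintegral_insertNth (paramLaw d r) 0 (measurable_capSup_flat (ι := Fin (q + 1)) a hr)

/-- Replaces the law depending on `r` by the hyperplane measure, on which translations, scalings and
rotations act simply. -/
theorem lintegral_flatMeasure_capSup_inter (hd : 1 ≤ d) (a q : ℕ) {r : ℝ} (hr : 0 < r)
    (y : Param d) :
    ∫⁻ x : Fin q → Param d, capSup a r ((⋂ j, H (x j)) ∩ H y) ∂(Measure.pi fun _ => flatMeasure d)
      = ENNReal.ofReal (2 * r) ^ q * sectionMean a q r y := by
  rw [lintegral_pi_paramLaw hd hr, Fintype.card_fin, sectionMean]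
  intro x hx j
  rw [← iInter_H_insertNth 0] at hx
  simpa using mem_box_of_capSup_ne_zero hr hx (Fin.succ j)

/-- Rotation invariance, applied to the reflection that takes `v` to `w`. -/
theorem sectionMean_central_eq (hd : 1 ≤ d) (a q : ℕ) (v w : Sph d) :
    sectionMean a q 1 ((0 : ℝ), v) = sectionMean a q 1 ((0 : ℝ), w) := by
  let g : E d ≃ₗᵢ[ℝ] E d := Submodule.reflection (ℝ ∙ ((v : E d) - w))ᗮ
  have hg : sphMap g v = w := Subtype.ext (Submodule.reflection_sub (by simp))
  have h1 := lintegral_flatMeasure_capSup_inter hd a q one_pos ((0 : ℝ), v)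
  have h2 := lintegral_flatMeasure_capSup_inter hd a q one_pos ((0 : ℝ), w)
  have h3 : ∫⁻ x : Fin q → Param d, capSup a 1 ((⋂ j, H (x j)) ∩ H ((0 : ℝ), v))
        ∂(Measure.pi fun _ => flatMeasure d)
      = ∫⁻ x : Fin q → Param d, capSup a 1 ((⋂ j, H (x j)) ∩ H ((0 : ℝ), w))
        ∂(Measure.pi fun _ => flatMeasure d) := by
    rw [← lintegral_pi_rotate hd g (measurable_capSup_flat_inter a one_pos ((0 : ℝ), w))]
    · refine lintegral_congr fun x => ?_
      have h4 : (⋂ j, H (rotate g (x j))) ∩ H ((0 : ℝ), w)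
          = g.symm ⁻¹' ((⋂ j, H (x j)) ∩ H ((0 : ℝ), v)) := by
        have h5 : ((0 : ℝ), w) = rotate g ((0 : ℝ), v) := by simp [rotate, hg]
        rw [h5, Set.preimage_inter, Set.preimage_iInter, H_rotate]
        simp only [H_rotate]
      rw [h4, capSup_preimage_isometry]
    · intro x x' hxx
      simp only [hxx]
  rw [h3, h2] at h1
  refine ((ENNReal.mul_right_inj ?_ ?_).1 h1).symm
  · simp
  · exact ENNReal.pow_ne_top ENNReal.ofReal_ne_top

/-- The section mean depends on `y` only through its distance to the origin. -/
theorem sectionMean_eq (hd : 1 ≤ d) (a q : ℕ) {r : ℝ} (hr : 0 < r) {y : Param d} (hy : |y.1| < r)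
    (v : Sph d) :
    sectionMean a q r y
      = ENNReal.ofReal (√(1 - (y.1 / r) ^ 2) ^ (a + q)) * sectionMean a q 1 ((0 : ℝ), v) := by
  have hpr : (y.1 / r) ^ 2 < 1 := by
    rw [sq_lt_one_iff_abs_lt_one, abs_div, abs_of_pos hr, div_lt_one hr]
    exact hy
  have h1 := lintegral_flatMeasure_capSup_inter hd a q hr y
  simp only [capSup_inter_H a hr hy] at h1
  set s := √(1 - (y.1 / r) ^ 2) with hs
  have hs0 : 0 < s := Real.sqrt_pos.2 (by linarith)
  have hm := measurable_capSup_flat_inter (q := q) a one_pos ((0 : ℝ), y.2)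
  have hm' : Measurable fun x : Fin q → Param d => capSup a 1
      ((⋂ j, H (shiftScale (y.1 • (y.2 : E d)) (s * r) (x j))) ∩ H ((0 : ℝ), y.2)) :=
    hm.comp (measurable_pi_lambda _ fun j =>
      (measurable_shiftScale _ _).comp (measurable_pi_apply j))
  -- The profile contributes `s^a` and the change of variables `(s r)^q`; dividing by `r^q` leaves
  -- `s^(a+q)`.
  rw [lintegral_const_mul _ hm', lintegral_pi_shiftScale _ (by positivity) hm,
    lintegral_flatMeasure_capSup_inter hd a q one_pos, Fintype.card_fin,
    sectionMean_central_eq hd a q y.2 v] at h1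
  have h2 : ENNReal.ofReal (2 * r) ^ q * (ENNReal.ofReal (s ^ (a + q))
      * sectionMean a q 1 ((0 : ℝ), v)) = ENNReal.ofReal (2 * r) ^ q * sectionMean a q r y := by
    rw [← h1]
    simp only [← mul_assoc]
    congr 1
    rw [← ENNReal.ofReal_pow (by positivity), ← ENNReal.ofReal_pow (by positivity),
      ← ENNReal.ofReal_pow (by positivity), ← ENNReal.ofReal_mul (by positivity),
      ← ENNReal.ofReal_mul (by positivity), ← ENNReal.ofReal_mul (by positivity)]
    congr 1
    rw [pow_add, mul_pow, mul_pow]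
    ring
  refine ((ENNReal.mul_right_inj ?_ ?_).1 h2).symm
  · simpa using fun h => absurd h (not_le.2 hr)
  · exact ENNReal.pow_ne_top ENNReal.ofReal_ne_top

/-- If it vanished, scaling would make the section means vanish for every radius, so almost no `q +
1` hyperplanes would meet inside any ball; but `q + 1 ≤ d` hyperplanes in general position do meet.
-/
theorem sectionMean_central_ne_zero {q : ℕ} (a : ℕ) (hq : q + 1 ≤ d) (v : Sph d) :
    sectionMean a q 1 ((0 : ℝ), v) ≠ 0 := by
  have hd : 1 ≤ d := by omega
  intro h0
  have h1 : ∀ n : ℕ, ∀ᵐ x ∂(Measure.pi fun _ : Fin (q + 1) => flatMeasure d),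
      capSup a ((n : ℝ) + 1) (⋂ j, H (x j)) = 0 := by
    intro n
    have hr : (0 : ℝ) < (n : ℝ) + 1 := by positivity
    have := isProbabilityMeasure_paramLaw hd hr
    have hm := measurable_capSup_flat (ι := Fin (q + 1)) (d := d) a hr
    refine (lintegral_eq_zero_iff hm).1 ?_
    rw [lintegral_pi_paramLaw hd hr fun x hx j => mem_box_of_capSup_ne_zero hr hx j,
      lintegral_pi_insertNth _ 0 hm]
    refine mul_eq_zero_of_right _ ?_
    simp only [lintegral_capSup_insertNth]
    rw [lintegral_eq_zero_iff (measurable_sectionMean hd a q hr)]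
    filter_upwards [ae_paramLaw_abs_lt ((n : ℝ) + 1)] with y hy
    rw [sectionMean_eq hd a q hr hy v, h0, mul_zero]
    rfl
  have h2 : ∀ᵐ x ∂(Measure.pi fun _ : Fin (q + 1) => flatMeasure d), False := by
    filter_upwards [ae_all_iff.2 h1, ae_linearIndependent hq] with x hx hli
    obtain ⟨z, -, hz⟩ := flat_eq_add_orthogonal hli
    obtain ⟨n, hn⟩ := exists_nat_gt ‖z‖
    have hzm : z ∈ ⋂ j, H (x j) := (hz z).2 (by simp)
    have h3 : cap a (‖z‖ / ((n : ℝ) + 1)) ≤ capSup a ((n : ℝ) + 1) (⋂ j, H (x j)) :=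
      le_iSup₂_of_le z hzm le_rfl
    rw [hx n] at h3
    exact (cap_pos a (by positivity) ((div_lt_one (by positivity)).2 (by linarith))).not_ge h3
  have := isProbabilityMeasure_unifDir hd
  have h3 : flatMeasure d Set.univ = ∞ := by
    rw [flatMeasure, ← Set.univ_prod_univ, Measure.prod_prod]
    simp
  have h4 : Measure.pi (fun _ : Fin (q + 1) => flatMeasure d) Set.univ = 0 := by
    simpa [ae_iff] using h2
  rw [Measure.pi_univ] at h4
  simp [h3] at h4

/-- The section mean, up to a constant which does not depend on the radius. -/
theorem exists_sectionMean_eq {q : ℕ} (a : ℕ) (hq : q + 1 ≤ d) :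
    ∃ A : ℝ, 0 < A ∧ ∀ r : ℝ, 0 < r → ∀ y : Param d, |y.1| < r →
      sectionMean a q r y = ENNReal.ofReal (A * √(1 - (y.1 / r) ^ 2) ^ (a + q)) := by
  have hd : 1 ≤ d := by omega
  let v : Sph d := ⟨EuclideanSpace.single ⟨0, hd⟩ 1, by simp⟩
  have hfin : sectionMean a q 1 ((0 : ℝ), v) ≠ ∞ :=
    ne_top_of_le_ne_top ENNReal.one_ne_top (sectionMean_le_one hd a q one_pos _)
  refine ⟨(sectionMean a q 1 ((0 : ℝ), v)).toReal,
    ENNReal.toReal_pos (sectionMean_central_ne_zero a hq v) hfin, fun r hr y hy => ?_⟩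
  rw [sectionMean_eq hd a q hr hy v, ENNReal.ofReal_mul ENNReal.toReal_nonneg,
    ENNReal.ofReal_toReal hfin, mul_comm]

theorem ae_pi_paramLaw {ι : Type*} [Fintype ι] (hd : 1 ≤ d) {r : ℝ} (hr : 0 < r)
    {p : (ι → Param d) → Prop} (h : ∀ᵐ x ∂(Measure.pi fun _ => flatMeasure d), p x) :
    ∀ᵐ x ∂(Measure.pi fun _ => paramLaw d r), p x := by
  have := isProbabilityMeasure_paramLaw hd hr
  have h1 := ae_restrict_of_ae (s := Set.univ.pi fun _ => box d r) h
  rw [Measure.restrict_pi_pi, flatMeasure_restrict_box hr, pi_const_smul _ ENNReal.ofReal_ne_top] at h1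
  rw [ae_iff, Measure.smul_apply, smul_eq_mul, mul_eq_zero] at h1
  refine ae_iff.2 (h1.resolve_left (pow_ne_zero _ ?_))
  simpa using hr

theorem gChi_eq (k : ℕ) {r : ℝ} (hr : 0 < r) (y : Param d) :
    gChi d k r y = (sectionMean 0 (d - k - 1) r y).toReal := by
  rw [gChi, kernelMean, sectionMean, ← integral_toReal]
  · refine integral_congr_ae (ae_of_all _ fun x => ?_)
    simp only [chi_inter_ball hr]
  · exact (measurable_capSup_flat_inter 0 hr y).aemeasurable
  · exact ae_of_all _ fun x => (capSup_le_one _ _ _).trans_lt ENNReal.one_lt_top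

/-- The volume formula for sections requires independent normals, which is why equality holds only
for almost every `y`. -/
theorem gNu_ae_eq {k : ℕ} (hk : k < d) {r : ℝ} (hr : 0 < r) :
    ∀ᵐ y ∂(paramLaw d r), gNu d k r y
      = (unitBallVol k).toReal * (sectionMean k (d - k - 1) r y).toReal := by
  have hd : 1 ≤ d := by omega
  have := isProbabilityMeasure_paramLaw hd hr
  have h1 := ae_pi_paramLaw hd hr (ae_linearIndependent (d := d) (m := d - k - 1 + 1) (by omega))
  have h2 := (measurePreserving_piFinSuccAbove
    (fun _ : Fin (d - k - 1 + 1) => paramLaw d r) 0).symm.quasiMeasurePreserving.ae h1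
  filter_upwards [Measure.ae_ae_of_ae_prod h2] with y hy
  rw [gNu, kernelMean, sectionMean, ← integral_toReal]
  · rw [← integral_const_mul, ← integral_const_mul]
    refine integral_congr_ae ?_
    filter_upwards [hy] with x hx
    have h3 := nu_flat_inter_ball (k := k) (by omega) hr hx
    have h4 : (⋂ j, H (((MeasurableEquiv.piFinSuccAbove (fun _ => Param d)
        (0 : Fin (d - k - 1 + 1))).symm (y, x)) j)) = (⋂ j, H (x j)) ∩ H y :=
      iInter_H_insertNth 0 y x
    rw [h4] at h3
    rw [h3, ENNReal.toReal_mul, ENNReal.toReal_mul, ENNReal.toReal_ofReal (by positivity)]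
    field_simp
  · exact (measurable_capSup_flat_inter k hr y).aemeasurable
  · exact ae_of_all _ fun x => (capSup_le_one _ _ _).trans_lt ENNReal.one_lt_top

/-- The moments of `√(1 - p²)` for `p` uniform on `[-1, 1]`. -/
def radialMoment (N : ℕ) : ℝ := (1 / 2) * ∫ p in (-1 : ℝ)..1, √(1 - p ^ 2) ^ N

theorem integral_paramLaw_radial (hd : 1 ≤ d) {r : ℝ} (hr : 0 < r) (f : ℝ → ℝ) :
    ∫ y, f (y.1 / r) ∂(paramLaw d r) = (1 / 2) * ∫ p in (-1 : ℝ)..1, f p := by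
  have := isProbabilityMeasure_unifDir hd
  have h2 : (volume : Measure ℝ) (Set.Icc (-r) r) = ENNReal.ofReal (2 * r) := by
    rw [Real.volume_Icc]
    congr 1
    ring
  have hsf : IsFiniteMeasure (ProbabilityTheory.cond (volume : Measure ℝ) (Set.Icc (-r) r)) := by
    infer_instance
  rw [paramLaw, integral_fun_fst (f := fun p => f (p / r)), ProbabilityTheory.cond,
    integral_smul_measure, h2, integral_Icc_eq_integral_Ioc, ← intervalIntegral.integral_of_le (by linarith),
    intervalIntegral.integral_comp_div f hr.ne']
  have h3 : -r / r = -1 := by field_simp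
  have h4 : r / r = 1 := by field_simp
  rw [h3, h4, ENNReal.toReal_inv, ENNReal.toReal_ofReal (by positivity)]
  simp only [smul_eq_mul, probReal_univ, one_mul]
  field_simp

theorem radialMoment_pos (N : ℕ) : 0 < radialMoment N := by
  refine mul_pos (by norm_num) (intervalIntegral.intervalIntegral_pos_of_pos_on ?_ ?_ (by norm_num))
  · exact Continuous.intervalIntegrable (by fun_prop) _ _
  · intro p hp
    have : 0 < 1 - p ^ 2 := by nlinarith [hp.1, hp.2]
    positivity

theorem integrable_radial (hd : 1 ≤ d) {r : ℝ} (hr : 0 < r) (N : ℕ) :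
    Integrable (fun y : Param d => √(1 - (y.1 / r) ^ 2) ^ N) (paramLaw d r) := by
  have := isProbabilityMeasure_paramLaw hd hr
  refine Integrable.of_bound (C := 1) ?_ ?_
  · exact (by fun_prop : Measurable fun y : Param d =>
      √(1 - (y.1 / r) ^ 2) ^ N).aestronglyMeasurable
  · refine ae_of_all _ fun y => ?_
    rw [Real.norm_eq_abs, abs_of_nonneg (by positivity)]
    exact pow_le_one₀ (Real.sqrt_nonneg _) (Real.sqrt_le_one.2 (by nlinarith [sq_nonneg (y.1 / r)]))

/-- Only `y.1 / r` enters, and it is uniform on `[-1, 1]`. This gives the independence of the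
radius. -/
theorem lintegral_sectionMean_mul {a b m n : ℕ} (hd : 1 ≤ d) {A B : ℝ} (hA0 : 0 < A) (hB0 : 0 < B)
    (hA : ∀ r : ℝ, 0 < r → ∀ y : Param d, |y.1| < r →
      sectionMean a m r y = ENNReal.ofReal (A * √(1 - (y.1 / r) ^ 2) ^ (a + m)))
    (hB : ∀ r : ℝ, 0 < r → ∀ y : Param d, |y.1| < r →
      sectionMean b n r y = ENNReal.ofReal (B * √(1 - (y.1 / r) ^ 2) ^ (b + n)))
    {r : ℝ} (hr : 0 < r) :
    ∫⁻ y, sectionMean a m r y * sectionMean b n r y ∂(paramLaw d r)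
      = ENNReal.ofReal (A * B * radialMoment (a + m + (b + n))) := by
  rw [radialMoment, ← integral_paramLaw_radial hd hr fun p => √(1 - p ^ 2) ^ (a + m + (b + n)),
    ← integral_const_mul, ofReal_integral_eq_lintegral_ofReal]
  · refine lintegral_congr_ae ?_
    filter_upwards [ae_paramLaw_abs_lt r] with y hy
    rw [hA r hr y hy, hB r hr y hy, ← ENNReal.ofReal_mul (by positivity)]
    congr 1
    rw [pow_add _ (a + m)]
    ring
  · exact (integrable_radial hd hr _).const_mul _
  · exact ae_of_all _ fun y => by positivity

end SectionMean

/-! ### Second moments of the tuple sums and their leading order. -/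

section Covariance

variable {Ω : Type*} [MeasurableSpace Ω] {d : ℕ} {P : Measure Ω} {X : ℕ → Ω → Param d} {lam : ℝ}

/-- The sum of `capSup a r` over the intersections of all ordered `m`-tuples of distinct
hyperplanes. -/
def capSum (X : ℕ → Ω → Param d) (a m : ℕ) (r : ℝ) (ω : Ω) : ℝ≥0∞ :=
  ∑' e : Fin m ↪ ℕ, capSup a r (⋂ j, H (X (e j) ω))

theorem measurable_tsum_tuple (hX : ∀ i, Measurable (X i)) {ι : Type*} [Finite ι]
    {f : (ι → Param d) → ℝ≥0∞} (hf : Measurable f) :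
    Measurable fun ω => ∑' e : ι ↪ ℕ, f fun j => X (e j) ω :=
  Measurable.tsum fun e => by fun_prop

theorem measurable_capSum (hX : ∀ i, Measurable (X i)) (a m : ℕ) {r : ℝ} (hr : 0 < r) :
    Measurable (capSum X a m r) :=
  measurable_tsum_tuple hX (measurable_capSup_flat (ι := Fin m) a hr)

theorem intensity_restrict_box (hlam : 0 < lam) {r : ℝ} (hr : 0 < r) :
    (ENNReal.ofReal lam • (volume : Measure ℝ).prod (unifDir d)).restrict (box d r)
      = ENNReal.ofReal (2 * lam * r) • paramLaw d r := by
  change (ENNReal.ofReal lam • flatMeasure d).restrict (box d r) = _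
  rw [Measure.restrict_smul, flatMeasure_restrict_box hr, smul_smul,
    ← ENNReal.ofReal_mul hlam.le]
  congr 2
  ring

/-- The Campbell formula with the intensity on the box written as its total mass `2λr`, the mean
number of hyperplanes hitting `B_r`, times a probability law. -/
theorem lintegral_tsum_flat [IsProbabilityMeasure P] (hd : 1 ≤ d) (hlam : 0 < lam)
    (hX : IsIsotropicPoissonHyperplaneProcess d lam X P) {ι : Type*} [Fintype ι] {r : ℝ}
    (hr : 0 < r) {f : (ι → Param d) → ℝ≥0∞} (hf : Measurable f)
    (hsupp : ∀ x, f x ≠ 0 → ∀ j, x j ∈ box d r) :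
    ∫⁻ ω, ∑' e : ι ↪ ℕ, f (fun j => X (e j) ω) ∂P
      = ENNReal.ofReal (2 * lam * r) ^ Fintype.card ι
        * ∫⁻ x, f x ∂(Measure.pi fun _ => paramLaw d r) := by
  have := isProbabilityMeasure_paramLaw hd hr
  have hfin : (ENNReal.ofReal lam • (volume : Measure ℝ).prod (unifDir d)) (box d r) ≠ ∞ := by
    rw [← Measure.restrict_apply_univ, intensity_restrict_box hlam hr]
    simp
  rw [IsPoissonProcess.lintegral_tsum_embedding hX (measurableSet_box r) hfin hf hsupp]
  simp only [intensity_restrict_box hlam hr]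
  rw [pi_const_smul _ ENNReal.ofReal_ne_top, lintegral_smul_measure, smul_eq_mul]

theorem lintegral_capSum [IsProbabilityMeasure P] (hd : 1 ≤ d) (hlam : 0 < lam)
    (hX : IsIsotropicPoissonHyperplaneProcess d lam X P) (a m : ℕ) {r : ℝ} (hr : 0 < r) :
    ∫⁻ ω, capSum X a m r ω ∂P = ENNReal.ofReal (2 * lam * r) ^ m
      * ∫⁻ x : Fin m → Param d, capSup a r (⋂ j, H (x j)) ∂(Measure.pi fun _ => paramLaw d r) := by
  have := lintegral_tsum_flat hd hlam hX hr (measurable_capSup_flat (ι := Fin m) a hr)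
    (fun _ hx => mem_box_of_capSup_ne_zero hr hx)
  rwa [Fintype.card_fin] at this

theorem lintegral_capSum_ne_top [IsProbabilityMeasure P] (hd : 1 ≤ d) (hlam : 0 < lam)
    (hX : IsIsotropicPoissonHyperplaneProcess d lam X P) (a m : ℕ) {r : ℝ} (hr : 0 < r) :
    ∫⁻ ω, capSum X a m r ω ∂P ≠ ∞ := by
  have := isProbabilityMeasure_paramLaw hd hr
  rw [lintegral_capSum hd hlam hX a m hr]
  refine ENNReal.mul_ne_top (ENNReal.pow_ne_top ENNReal.ofReal_ne_top)
    (ne_top_of_le_ne_top ENNReal.one_ne_top ?_)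
  refine (lintegral_mono fun x => capSup_le_one _ _ _).trans ?_
  simp

/-- The expectation of a product of two sums over tuples of distinct hyperplanes. -/
theorem lintegral_tsum_mul_tsum [IsProbabilityMeasure P] (hd : 1 ≤ d) (hlam : 0 < lam)
    (hX : IsIsotropicPoissonHyperplaneProcess d lam X P) {α β : Type*} [Fintype α] [Fintype β]
    {r : ℝ} (hr : 0 < r) {f : (α → Param d) → ℝ≥0∞} {g : (β → Param d) → ℝ≥0∞} (hf : Measurable f)
    (hg : Measurable g) (hfs : ∀ x, f x ≠ 0 → ∀ j, x j ∈ box d r)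
    (hgs : ∀ x, g x ≠ 0 → ∀ j, x j ∈ box d r) :
    ∫⁻ ω, (∑' i : α ↪ ℕ, f fun j => X (i j) ω) * (∑' i : β ↪ ℕ, g fun j => X (i j) ω) ∂P
      = ∑ h : Overlap α β, ENNReal.ofReal (2 * lam * r) ^ Fintype.card h.Index
        * ∫⁻ x, f (fun a => x (Sum.inl a)) * g (fun b => x (h.pos b))
          ∂(Measure.pi fun _ : h.Index => paramLaw d r) := by
  have hpair : ∀ h : Overlap α β, Measurable fun x : h.Index → Param d =>
      f (fun a => x (Sum.inl a)) * g (fun b => x (h.pos b)) := fun h => by fun_prop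
  have h1 : ∀ ω, (∑' i : α ↪ ℕ, f fun j => X (i j) ω) * (∑' i : β ↪ ℕ, g fun j => X (i j) ω)
      = ∑ h : Overlap α β, ∑' e : h.Index ↪ ℕ,
        f (fun a => X (e (Sum.inl a)) ω) * g (fun b => X (e (h.pos b)) ω) := fun ω =>
    Overlap.tsum_mul_tsum (fun i => f fun j => X (i j) ω) (fun i => g fun j => X (i j) ω)
  have hXm : ∀ i, Measurable (X i) := hX.measurable
  simp only [h1]
  rw [lintegral_finsetSum]
  · refine Finset.sum_congr rfl fun h _ => ?_
    refine lintegral_tsum_flat hd hlam hX hr (hpair h) fun x hx j => ?_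
    have hx1 := left_ne_zero_of_mul hx
    have hx2 := right_ne_zero_of_mul hx
    rcases j with j | ⟨b, hb⟩
    · exact hfs _ hx1 j
    · rw [← h.pos_of_none hb]
      exact hgs _ hx2 b
  · intro h _
    refine Measurable.tsum fun e => ?_
    fun_prop

/-- The mixed second moments of the sums, with the leading terms made explicit. -/
theorem exists_lintegral_capSum_mul [IsProbabilityMeasure P] (hd : 1 ≤ d) (hlam : 0 < lam)
    (hX : IsIsotropicPoissonHyperplaneProcess d lam X P) (a b m n : ℕ) {r : ℝ} (hr : 0 < r)
    (hc : 1 ≤ 2 * lam * r) :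
    ∃ R ≤ (Fintype.card (Overlap (Fin (m + 1)) (Fin (n + 1))) : ℝ≥0∞)
        * ENNReal.ofReal (2 * lam * r) ^ (m + n),
      ∫⁻ ω, capSum X a (m + 1) r ω * capSum X b (n + 1) r ω ∂P
        = (∫⁻ ω, capSum X a (m + 1) r ω ∂P) * (∫⁻ ω, capSum X b (n + 1) r ω ∂P)
          + ((m + 1) * (n + 1) : ℕ) * (ENNReal.ofReal (2 * lam * r) ^ (m + n + 1)
            * ∫⁻ y, sectionMean a m r y * sectionMean b n r y ∂(paramLaw d r)) + R := by
  have := isProbabilityMeasure_paramLaw hd hr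
  set c := ENNReal.ofReal (2 * lam * r) with hcdef
  have hc1 : 1 ≤ c := by rwa [hcdef, ENNReal.one_le_ofReal]
  set f : (Fin (m + 1) → Param d) → ℝ≥0∞ := fun x => capSup a r (⋂ j, H (x j)) with hf
  set g : (Fin (n + 1) → Param d) → ℝ≥0∞ := fun x => capSup b r (⋂ j, H (x j)) with hg
  have hfm : Measurable f := measurable_capSup_flat a hr
  have hgm : Measurable g := measurable_capSup_flat b hr
  let I : Overlap (Fin (m + 1)) (Fin (n + 1)) → ℝ≥0∞ := fun h =>
    ∫⁻ x, f (fun a => x (Sum.inl a)) * g (fun b => x (h.pos b))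
        ∂(Measure.pi fun _ : h.Index => paramLaw d r)
  let Q : Overlap (Fin (m + 1)) (Fin (n + 1)) → ℝ≥0∞ := fun h => c ^ Fintype.card h.Index * I h
  have hQ : ∫⁻ ω, capSum X a (m + 1) r ω * capSum X b (n + 1) r ω ∂P = ∑ h, Q h :=
    lintegral_tsum_mul_tsum hd hlam hX hr hfm hgm (fun _ hx => mem_box_of_capSup_ne_zero hr hx)
      (fun _ hx => mem_box_of_capSup_ne_zero hr hx)
  obtain ⟨s, hs, hsum⟩ := Overlap.sum_eq Q
  refine ⟨∑ h ∈ s, Q h, ?_, ?_⟩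
  -- Two or more coincidences leave at most `m + n` distinct hyperplanes; the integrands are at most
  -- one and `c ≥ 1`.
  · have h1 : ∀ h ∈ s, Q h ≤ c ^ (m + n) := by
      intro h hh
      have h2 := Overlap.card_index_le h (hs h hh).1 (hs h hh).2
      simp only [Fintype.card_fin] at h2
      have h3 : I h ≤ 1 := by
        refine (lintegral_mono (g := fun _ => 1) fun x => ?_).trans (by simp)
        exact mul_le_one' (capSup_le_one _ _ _) (capSup_le_one _ _ _)
      calc Q h ≤ c ^ Fintype.card h.Index * 1 := mul_le_mul' le_rfl h3
        _ ≤ c ^ (m + n) := by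
          rw [mul_one]
          exact pow_le_pow_right₀ hc1 (by omega)
    calc ∑ h ∈ s, Q h ≤ ∑ h ∈ s, c ^ (m + n) := Finset.sum_le_sum h1
      _ ≤ ∑ h : Overlap (Fin (m + 1)) (Fin (n + 1)), c ^ (m + n) :=
        Finset.sum_le_sum_of_subset (Finset.subset_univ s)
      _ = _ := by rw [Finset.sum_const, nsmul_eq_mul, Finset.card_univ]
  · rw [hQ, hsum]
    congr 2
    · rw [lintegral_capSum hd hlam hX a (m + 1) hr, lintegral_capSum hd hlam hX b (n + 1) hr]
      simp only [Q, I]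
      rw [lintegral_overlap_empty _ hfm hgm, Overlap.card_index_empty]
      simp only [Fintype.card_fin, hf, hg, ← hcdef]
      ring
    · have h1 : ∀ p, Q (Overlap.single p) = c ^ (m + n + 1)
          * ∫⁻ y, sectionMean a m r y * sectionMean b n r y ∂(paramLaw d r) := by
        intro p
        have h2 := Overlap.card_index_single p
        simp only [Fintype.card_fin] at h2
        simp only [Q, I]
        rw [lintegral_overlap_single (paramLaw d r) hfm hgm
          (fun i y => lintegral_capSup_insertNth a m r i y)
          (fun i y => lintegral_capSup_insertNth b n r i y) p]
        congr 2
        omega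
      simp only [h1]
      rw [Finset.sum_const, nsmul_eq_mul, Finset.card_univ, Fintype.card_prod, Fintype.card_fin,
        Fintype.card_fin]

theorem integrable_capSum [IsProbabilityMeasure P] (hd : 1 ≤ d) (hlam : 0 < lam)
    (hX : IsIsotropicPoissonHyperplaneProcess d lam X P) (a m : ℕ) {r : ℝ} (hr : 0 < r) :
    Integrable (fun ω => (capSum X a m r ω).toReal) P :=
  integrable_toReal_of_lintegral_ne_top (measurable_capSum hX.measurable a m hr).aemeasurable
    (lintegral_capSum_ne_top hd hlam hX a m hr)

/-- The centred and normalized sum of `capSup a r` over the intersections of `m + 1` distinct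
hyperplanes. -/
def normSum (X : ℕ → Ω → Param d) (P : Measure Ω) (lam : ℝ) (a m : ℕ) (r : ℝ) (ω : Ω) : ℝ :=
  (m ! : ℝ) / (2 * lam * r) ^ ((m : ℝ) + 1 / 2) / ((m + 1)! : ℝ)
    * ((capSum X a (m + 1) r ω).toReal - ∫ ω', (capSum X a (m + 1) r ω').toReal ∂P)

/-- The mixed second moments of the normalized sums, up to an error of order `1 / r`. -/
theorem integral_normSum_mul [IsProbabilityMeasure P] (hd : 1 ≤ d) (hlam : 0 < lam)
    (hX : IsIsotropicPoissonHyperplaneProcess d lam X P) (a b m n : ℕ) {r : ℝ} (hr : 0 < r)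
    (hc : 1 ≤ 2 * lam * r) {J : ℝ} (hJ0 : 0 ≤ J)
    (hJ : ∫⁻ y, sectionMean a m r y * sectionMean b n r y ∂(paramLaw d r) = ENNReal.ofReal J) :
    Integrable (fun ω => normSum X P lam a m r ω * normSum X P lam b n r ω) P ∧
    J ≤ ∫ ω, normSum X P lam a m r ω * normSum X P lam b n r ω ∂P ∧
    ∫ ω, normSum X P lam a m r ω * normSum X P lam b n r ω ∂P
      ≤ J + Fintype.card (Overlap (Fin (m + 1)) (Fin (n + 1))) / (2 * lam * r) := by
  obtain ⟨R, hR, hmom⟩ := exists_lintegral_capSum_mul hd hlam hX a b m n hr hc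
  set c := 2 * lam * r with hcdef
  have hc0 : 0 < c := by linarith
  set K := Fintype.card (Overlap (Fin (m + 1)) (Fin (n + 1)))
  rw [hJ] at hmom
  have hRtop : R ≠ ∞ := ne_top_of_le_ne_top (ENNReal.mul_ne_top (ENNReal.natCast_ne_top _)
    (ENNReal.pow_ne_top ENNReal.ofReal_ne_top)) hR
  have hftop := lintegral_capSum_ne_top hd hlam hX a (m + 1) hr
  have hgtop := lintegral_capSum_ne_top hd hlam hX b (n + 1) hr
  set f : Ω → ℝ := fun ω => (capSum X a (m + 1) r ω).toReal with hf
  set g : Ω → ℝ := fun ω => (capSum X b (n + 1) r ω).toReal with hg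
  have hfm := measurable_capSum hX.measurable a (m + 1) hr
  have hgm := measurable_capSum hX.measurable b (n + 1) hr
  have hfi : Integrable f P := integrable_capSum hd hlam hX a (m + 1) hr
  have hgi : Integrable g P := integrable_capSum hd hlam hX b (n + 1) hr
  have hJtop : ((m + 1) * (n + 1) : ℕ) * (ENNReal.ofReal c ^ (m + n + 1) * ENNReal.ofReal J) ≠ ∞ :=
    ENNReal.mul_ne_top (ENNReal.natCast_ne_top _) (ENNReal.mul_ne_top
      (ENNReal.pow_ne_top ENNReal.ofReal_ne_top) ENNReal.ofReal_ne_top)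
  have hfgtop : ∫⁻ ω, capSum X a (m + 1) r ω * capSum X b (n + 1) r ω ∂P ≠ ∞ := by
    rw [hmom]
    exact ENNReal.add_ne_top.2 ⟨ENNReal.add_ne_top.2 ⟨ENNReal.mul_ne_top hftop hgtop, hJtop⟩, hRtop⟩
  have hfgi : Integrable (fun ω => f ω * g ω) P := by
    have := integrable_toReal_of_lintegral_ne_top (hfm.mul hgm).aemeasurable hfgtop
    simpa [hf, hg, ENNReal.toReal_mul] using this
  have hEf : (∫⁻ ω, capSum X a (m + 1) r ω ∂P).toReal = ∫ ω, f ω ∂P :=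
    (integral_toReal hfm.aemeasurable (ae_lt_top hfm hftop)).symm
  have hEg : (∫⁻ ω, capSum X b (n + 1) r ω ∂P).toReal = ∫ ω, g ω ∂P :=
    (integral_toReal hgm.aemeasurable (ae_lt_top hgm hgtop)).symm
  have hEfg : ∫ ω, f ω * g ω ∂P = (∫ ω, f ω ∂P) * (∫ ω, g ω ∂P)
      + ((m + 1) * (n + 1)) * (c ^ (m + n + 1) * J) + R.toReal := by
    have h1 := integral_toReal (hfm.mul hgm).aemeasurable (ae_lt_top (hfm.mul hgm) hfgtop)
    simp only [Pi.mul_apply] at h1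
    rw [hmom, ENNReal.toReal_add (ENNReal.add_ne_top.2 ⟨ENNReal.mul_ne_top hftop hgtop, hJtop⟩) hRtop,
      ENNReal.toReal_add (ENNReal.mul_ne_top hftop hgtop) hJtop, ENNReal.toReal_mul, hEf, hEg,
      ENNReal.toReal_mul, ENNReal.toReal_mul, ENNReal.toReal_pow, ENNReal.toReal_ofReal hJ0,
      ENNReal.toReal_ofReal hc0.le, ENNReal.toReal_natCast] at h1
    simp only [ENNReal.toReal_mul] at h1
    rw [h1]
    push_cast
    ring
  have hR' : R.toReal ≤ K * c ^ (m + n) := by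
    have := ENNReal.toReal_mono (ENNReal.mul_ne_top (ENNReal.natCast_ne_top _)
      (ENNReal.pow_ne_top ENNReal.ofReal_ne_top)) hR
    rwa [ENNReal.toReal_mul, ENNReal.toReal_natCast, ENNReal.toReal_pow,
      ENNReal.toReal_ofReal hc0.le] at this
  set μf := ∫ ω, f ω ∂P with hμf
  set μg := ∫ ω, g ω ∂P with hμg
  have hcov : ∫ ω, (f ω - μf) * (g ω - μg) ∂P
      = ((m + 1) * (n + 1)) * (c ^ (m + n + 1) * J) + R.toReal := by
    have h1 : ∀ ω, (f ω - μf) * (g ω - μg) = f ω * g ω - μg * f ω - μf * g ω + μf * μg := by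
      intro ω
      ring
    simp only [h1]
    have e1 : Integrable (fun ω => f ω * g ω - μg * f ω) P := hfgi.sub (hfi.const_mul _)
    have e2 : Integrable (fun ω => f ω * g ω - μg * f ω - μf * g ω) P := e1.sub (hgi.const_mul _)
    rw [integral_add e2 (integrable_const _), integral_sub e1 (hgi.const_mul _),
      integral_sub hfgi (hfi.const_mul _), integral_const_mul, integral_const_mul, integral_const,
      hEfg, ← hμf, ← hμg]
    simp only [probReal_univ, smul_eq_mul]
    ring
  have hcovi : Integrable (fun ω => (f ω - μf) * (g ω - μg)) P := by
    have h1 : (fun ω => (f ω - μf) * (g ω - μg))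
        = fun ω => f ω * g ω - μg * f ω - μf * g ω + μf * μg := by
      funext ω
      ring
    rw [h1]
    exact ((hfgi.sub (hfi.const_mul _)).sub (hgi.const_mul _)).add (integrable_const _)
  -- The half-integer exponents add up to the order of the terms with one coincidence.
  have hpow : c ^ ((m : ℝ) + 1 / 2) * c ^ ((n : ℝ) + 1 / 2) = c ^ (m + n + 1) := by
    rw [← Real.rpow_add hc0, ← Real.rpow_natCast]
    congr 1
    push_cast
    ring
  -- The ratios `m!/(m+1)!` and `n!/(n+1)!` produce the reciprocal of `(m+1)(n+1)`, the number of
  -- single overlaps, so the leading term becomes exactly `J`.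
  have hprod : ∀ ω, normSum X P lam a m r ω * normSum X P lam b n r ω
      = (((m + 1) * (n + 1)) * c ^ (m + n + 1))⁻¹ * ((f ω - μf) * (g ω - μg)) := by
    intro ω
    change (m ! : ℝ) / c ^ ((m : ℝ) + 1 / 2) / ((m + 1)! : ℝ) * (f ω - μf)
      * ((n ! : ℝ) / c ^ ((n : ℝ) + 1 / 2) / ((n + 1)! : ℝ) * (g ω - μg)) = _
    rw [← hpow, Nat.factorial_succ m, Nat.factorial_succ n]
    have h1 : (m ! : ℝ) ≠ 0 := by positivity
    have h2 : (n ! : ℝ) ≠ 0 := by positivity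
    have h3 : c ^ ((m : ℝ) + 1 / 2) ≠ 0 := by positivity
    have h4 : c ^ ((n : ℝ) + 1 / 2) ≠ 0 := by positivity
    push_cast
    field_simp
  simp only [hprod]
  rw [integral_const_mul, hcov]
  have hN : (0 : ℝ) < (m + 1) * (n + 1) := by positivity
  have hcp : 0 < c ^ (m + n + 1) := by positivity
  have h5 : (((m + 1) * (n + 1)) * c ^ (m + n + 1))⁻¹
      * (((m + 1) * (n + 1)) * (c ^ (m + n + 1) * J) + R.toReal)
      = J + R.toReal / (((m + 1) * (n + 1)) * c ^ (m + n + 1)) := by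
    field_simp
  rw [h5]
  refine ⟨hcovi.const_mul _, le_add_of_nonneg_right (by positivity), ?_⟩
  refine add_le_add le_rfl ?_
  rw [div_le_div_iff₀ (by positivity) hc0]
  calc R.toReal * c ≤ K * c ^ (m + n) * c := by gcongr
    _ = K * c ^ (m + n + 1) := by ring
    _ ≤ K * (((m + 1) * (n + 1)) * c ^ (m + n + 1)) := by
      have h6 : (1 : ℝ) ≤ (m + 1) * (n + 1) := by
        have : (0 : ℝ) ≤ m := by positivity
        have : (0 : ℝ) ≤ n := by positivity
        nlinarith
      gcongr
      nlinarith

end Covariance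

/-! ### Limits of the covariances, and convergence in probability. -/

section Asymptotics

variable {Ω : Type*} [MeasurableSpace Ω] {d : ℕ} {P : Measure Ω} {X : ℕ → Ω → Param d} {lam : ℝ}

theorem tendsto_integral_normSum_mul [IsProbabilityMeasure P] (hd : 1 ≤ d) (hlam : 0 < lam)
    (hX : IsIsotropicPoissonHyperplaneProcess d lam X P) (a b m n : ℕ) {J : ℝ} (hJ0 : 0 ≤ J)
    (hJ : ∀ r : ℝ, 0 < r → ∫⁻ y, sectionMean a m r y * sectionMean b n r y ∂(paramLaw d r)
      = ENNReal.ofReal J) :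
    (∀ᶠ r in atTop, Integrable (fun ω => normSum X P lam a m r ω * normSum X P lam b n r ω) P) ∧
    Tendsto (fun r => ∫ ω, normSum X P lam a m r ω * normSum X P lam b n r ω ∂P) atTop (𝓝 J) := by
  have hlarge : ∀ᶠ r : ℝ in atTop, 0 < r ∧ 1 ≤ 2 * lam * r := by
    filter_upwards [eventually_gt_atTop 0, eventually_ge_atTop (1 / (2 * lam))] with r h0 h1
    refine ⟨h0, ?_⟩
    rw [div_le_iff₀ (by positivity)] at h1
    linarith
  refine ⟨?_, ?_⟩
  · filter_upwards [hlarge] with r hr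
    exact (integral_normSum_mul hd hlam hX a b m n hr.1 hr.2 hJ0 (hJ r hr.1)).1
  · have hbound : Tendsto (fun r : ℝ => J + (Fintype.card (Overlap (Fin (m + 1)) (Fin (n + 1))) : ℝ)
        / (2 * lam * r)) atTop (𝓝 J) := by
      have h1 : Tendsto (fun r : ℝ => 2 * lam * r) atTop atTop :=
        tendsto_id.const_mul_atTop (by positivity)
      simpa using (tendsto_const_nhds (x := J)).add (tendsto_const_nhds.div_atTop h1)
    refine tendsto_of_tendsto_of_tendsto_of_le_of_le' tendsto_const_nhds hbound ?_ ?_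
    · filter_upwards [hlarge] with r hr
      exact (integral_normSum_mul hd hlam hX a b m n hr.1 hr.2 hJ0 (hJ r hr.1)).2.1
    · filter_upwards [hlarge] with r hr
      exact (integral_normSum_mul hd hlam hX a b m n hr.1 hr.2 hJ0 (hJ r hr.1)).2.2

/-- With `m = d - k - 1`, tuples have length `m + 1` and the normalizing exponent is `m + 1/2`. -/
theorem ZChi_eq_normSum {k : ℕ} (hk : k < d) {r : ℝ} (hr : 0 < r) (ω : Ω) :
    ZChi X P lam k r ω = normSum X P lam 0 (d - k - 1) r ω := by
  have hm : d - k = d - k - 1 + 1 := by omega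
  have hexp : (d : ℝ) - k - 1 / 2 = ((d - k - 1 : ℕ) : ℝ) + 1 / 2 := by
    have : (d : ℝ) = k + ((d - k - 1 : ℕ) + 1) := by
      exact_mod_cast (by omega : d = k + (d - k - 1 + 1))
    rw [this]
    ring
  have hcount : ∀ ω, flatCount X k r ω
      = (capSum X 0 (d - k - 1 + 1) r ω).toReal / ((d - k - 1 + 1)! : ℕ) := by
    intro ω
    rw [flatCount, tupleSum, ← hm]
    simp only [chi_inter_ball hr]
    rfl
  unfold ZChi normSum
  simp only [hcount]
  rw [hexp, integral_div]
  field_simp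

/-- Almost surely, any `m ≤ d` distinct hyperplanes are in general position. -/
theorem ae_forall_linearIndependent [IsProbabilityMeasure P] (hd : 1 ≤ d) (hlam : 0 < lam)
    (hX : IsIsotropicPoissonHyperplaneProcess d lam X P) {m : ℕ} (hm : m ≤ d) :
    ∀ᵐ ω ∂P, ∀ e : Fin m ↪ ℕ, LinearIndependent ℝ fun j => ((X (e j) ω).2 : E d) := by
  let N : Set (Fin m → Param d) := {x | ¬ LinearIndependent ℝ fun j => ((x j).2 : E d)}
  have hN : MeasurableSet N := by
    have h1 : IsOpen {f : Fin m → E d | LinearIndependent ℝ f} := isOpen_setOfPred_linearIndependent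
    have h2 : Measurable fun (x : Fin m → Param d) j => ((x j).2 : E d) := by fun_prop
    exact (h2 h1.measurableSet).compl
  -- By the Campbell formula the expected number of dependent tuples in a box is zero. Boxes keep
  -- the intensity finite, and they exhaust the parameter space.
  have key : ∀ n : ℕ, ∀ᵐ ω ∂P, ∀ e : Fin m ↪ ℕ, (∀ j, X (e j) ω ∈ box d ((n : ℝ) + 1)) →
      LinearIndependent ℝ fun j => ((X (e j) ω).2 : E d) := by
    intro n
    have hr : (0 : ℝ) < (n : ℝ) + 1 := by positivity
    let B : Set (Fin m → Param d) := Set.univ.pi fun _ => box d ((n : ℝ) + 1)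
    have hB : MeasurableSet B := MeasurableSet.univ_pi fun _ => measurableSet_box _
    let f : (Fin m → Param d) → ℝ≥0∞ := (N ∩ B).indicator 1
    have hf : Measurable f := measurable_one.indicator (hN.inter hB)
    have h0 := lintegral_tsum_flat hd hlam hX hr hf (fun x hx j =>
      (Set.mem_of_indicator_ne_zero hx).2 j trivial)
    have h1 : ∫⁻ x, f x ∂(Measure.pi fun _ => paramLaw d ((n : ℝ) + 1)) = 0 := by
      rw [lintegral_eq_zero_iff hf]
      filter_upwards [ae_pi_paramLaw hd hr (ae_linearIndependent hm)] with x hx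
      exact Set.indicator_of_notMem (fun h => h.1 hx) _
    rw [h1, mul_zero, lintegral_eq_zero_iff (measurable_tsum_tuple hX.measurable hf)] at h0
    filter_upwards [h0] with ω hω e he
    have h2 := ENNReal.tsum_eq_zero.1 hω e
    by_contra hcon
    have h3 : (fun j => X (e j) ω) ∈ N ∩ B := ⟨hcon, fun j _ => he j⟩
    simp [f, Set.indicator_of_mem h3] at h2
  filter_upwards [ae_all_iff.2 key] with ω hω e
  obtain ⟨n, hn⟩ : ∃ n : ℕ, ∀ j, |(X (e j) ω).1| ≤ (n : ℝ) := by
    obtain ⟨n, hn⟩ := exists_nat_ge (∑ j, |(X (e j) ω).1|)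
    refine ⟨n, fun j => le_trans ?_ hn⟩
    exact Finset.single_le_sum (f := fun j => |(X (e j) ω).1|) (fun _ _ => abs_nonneg _)
      (Finset.mem_univ j)
  refine hω n e fun j => ⟨abs_le.1 ((hn j).trans (by linarith)), trivial⟩

/-- Almost surely all tuples are in general position, so each section volume is `unitBallVol k * r ^
k` times `capSup`; the factor `r⁻ᵏ` in `ZNu` cancels the power. -/
theorem ZNu_ae_eq_normSum [IsProbabilityMeasure P] (hlam : 0 < lam)
    (hX : IsIsotropicPoissonHyperplaneProcess d lam X P) {k : ℕ} (hk : k < d) {r : ℝ} (hr : 0 < r) :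
    ∀ᵐ ω ∂P, ZNu X P lam k r ω
      = (unitBallVol k).toReal * normSum X P lam k (d - k - 1) r ω := by
  have hd : 1 ≤ d := by omega
  have hm : d - k = d - k - 1 + 1 := by omega
  have hexp : (d : ℝ) - k - 1 / 2 = ((d - k - 1 : ℕ) : ℝ) + 1 / 2 := by
    have : (d : ℝ) = k + ((d - k - 1 : ℕ) + 1) := by
      exact_mod_cast (by omega : d = k + (d - k - 1 + 1))
    rw [this]
    ring
  have hvol : ∀ᵐ ω ∂P, totalVol X k r ω = (unitBallVol k).toReal * r ^ k
      / ((d - k - 1 + 1)! : ℕ) * (capSum X k (d - k - 1 + 1) r ω).toReal := by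
    filter_upwards [ae_forall_linearIndependent (m := d - k) hd hlam hX (by omega)] with ω hω
    have h1 : ∀ e : Fin (d - k) ↪ ℕ, nu k ((⋂ j, H (X (e j) ω)) ∩ ball d r)
        = unitBallVol k * ENNReal.ofReal (r ^ k) * capSup k r (⋂ j, H (X (e j) ω)) :=
      fun e => nu_flat_inter_ball (by omega) hr (hω e)
    rw [totalVol, tupleSum, ← hm]
    simp only [h1]
    rw [ENNReal.tsum_mul_left, ENNReal.toReal_mul, ENNReal.toReal_mul,
      ENNReal.toReal_ofReal (by positivity), capSum]
    ring
  filter_upwards [hvol] with ω hω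
  unfold ZNu normSum
  rw [integral_congr_ae hvol, hω, hexp, integral_const_mul]
  field_simp

/-- Two square integrable families whose limiting second moments are those of proportional
variables have asymptotically proportional values. -/
theorem tendstoInMeasure_div_sub_div [IsProbabilityMeasure P] {U V : ℝ → Ω → ℝ} {a b : ℝ}
    (ha : a ≠ 0) (hb : b ≠ 0)
    (hUU : ∀ᶠ r in atTop, Integrable (fun ω => U r ω * U r ω) P)
    (hUV : ∀ᶠ r in atTop, Integrable (fun ω => U r ω * V r ω) P)
    (hVV : ∀ᶠ r in atTop, Integrable (fun ω => V r ω * V r ω) P)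
    (hU : Tendsto (fun r => ∫ ω, U r ω * U r ω ∂P) atTop (𝓝 (a * a)))
    (hM : Tendsto (fun r => ∫ ω, U r ω * V r ω ∂P) atTop (𝓝 (a * b)))
    (hV : Tendsto (fun r => ∫ ω, V r ω * V r ω ∂P) atTop (𝓝 (b * b))) :
    TendstoInMeasure P (fun r ω => U r ω / a - V r ω / b) atTop fun _ => 0 := by
  -- The expansion of `𝔼 (U/a - V/b)²`, with limit `1 - 2 + 1 = 0`; Chebyshev's inequality then
  -- gives convergence in measure.
  have hlim : Tendsto (fun r => (∫ ω, U r ω * U r ω ∂P) / (a * a)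
      - 2 * (∫ ω, U r ω * V r ω ∂P) / (a * b) + (∫ ω, V r ω * V r ω ∂P) / (b * b)) atTop (𝓝 0) := by
    have h1 := ((hU.div_const (a * a)).sub ((hM.const_mul 2).div_const (a * b))).add
      (hV.div_const (b * b))
    have h2 : a * a / (a * a) - 2 * (a * b) / (a * b) + b * b / (b * b) = 0 := by
      field_simp
      norm_num
    rwa [h2] at h1
  rw [tendstoInMeasure_iff_measureReal_norm]
  intro ε hε
  have hlim2 := hlim.div_const (ε ^ 2)
  rw [zero_div] at hlim2
  refine squeeze_zero' (Eventually.of_forall fun r => measureReal_nonneg) ?_ hlim2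
  filter_upwards [hUU, hUV, hVV] with r h1 h2 h3
  have hexpand : (fun ω => (U r ω / a - V r ω / b) ^ 2) = fun ω =>
      (a * a)⁻¹ * (U r ω * U r ω) - 2 * (a * b)⁻¹ * (U r ω * V r ω)
        + (b * b)⁻¹ * (V r ω * V r ω) := by
    funext ω
    field_simp
    ring
  have e1 : Integrable (fun ω => (a * a)⁻¹ * (U r ω * U r ω)
      - 2 * (a * b)⁻¹ * (U r ω * V r ω)) P := (h1.const_mul _).sub (h2.const_mul _)
  have hint : Integrable (fun ω => (U r ω / a - V r ω / b) ^ 2) P := by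
    rw [hexpand]
    exact e1.add (h3.const_mul _)
  have hcheb := mul_meas_ge_le_integral_of_nonneg (ae_of_all P fun ω =>
    sq_nonneg (U r ω / a - V r ω / b)) hint (ε ^ 2)
  have hset : {ω | ε ≤ ‖U r ω / a - V r ω / b - 0‖}
      = {ω | ε ^ 2 ≤ (U r ω / a - V r ω / b) ^ 2} := by
    ext ω
    change ε ≤ ‖U r ω / a - V r ω / b - 0‖ ↔ ε ^ 2 ≤ (U r ω / a - V r ω / b) ^ 2
    rw [sub_zero, Real.norm_eq_abs, ← sq_abs (U r ω / a - V r ω / b)]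
    exact (pow_le_pow_iff_left₀ hε.le (abs_nonneg _) two_ne_zero).symm
  rw [hset, le_div_iff₀ (by positivity), mul_comm]
  refine hcheb.trans (le_of_eq ?_)
  rw [hexpand, integral_add e1 (h3.const_mul _), integral_sub (h1.const_mul _) (h2.const_mul _),
    integral_const_mul, integral_const_mul, integral_const_mul]
  field_simp

end Asymptotics

/-! ### Ranks of the limiting covariance matrices. -/

section Rank

/-- Substituting `s = √(1 - p²)`, which covers `[0, 1]`, gives a polynomial with infinitely many
roots; distinct exponents make the `x k` its coefficients. -/
theorem sum_radial_eq_zero {d : ℕ} {q : Fin d → ℕ} (hq : Function.Injective q) {x : Fin d → ℝ}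
    (h : ∀ p ∈ Set.Icc (-1 : ℝ) 1, ∑ k, x k * √(1 - p ^ 2) ^ q k = 0) : x = 0 := by
  let p : Polynomial ℝ := ∑ k, Polynomial.monomial (q k) (x k)
  have hp : p = 0 := by
    refine Polynomial.eq_zero_of_infinite_isRoot p ((Set.Icc_infinite (zero_lt_one' ℝ)).mono ?_)
    intro s hs
    have h1 : 0 ≤ 1 - s ^ 2 := by nlinarith [hs.1, hs.2]
    have h2 : √(1 - √(1 - s ^ 2) ^ 2) = s := by
      rw [Real.sq_sqrt h1, sub_sub_cancel, Real.sqrt_sq hs.1]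
    have h3 := h (√(1 - s ^ 2)) ⟨by linarith [Real.sqrt_nonneg (1 - s ^ 2)],
      Real.sqrt_le_one.2 (by nlinarith [sq_nonneg s])⟩
    rw [h2] at h3
    change p.eval s = 0
    simpa [p, Polynomial.eval_finsetSum] using h3
  funext k
  have h1 : p.coeff (q k) = x k := by
    simp only [p, Polynomial.finsetSum_coeff, Polynomial.coeff_monomial]
    rw [Finset.sum_eq_single k]
    · simp
    · intro l _ hl
      rw [if_neg fun h => hl (hq h)]
    · simp
  rw [← h1, hp]
  simp

/-- Gram matrices of distinct powers of `√(1 - p²)` have full rank. -/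
theorem rank_radialMoment {d : ℕ} {A : Fin d → ℝ} (hA : ∀ k, A k ≠ 0) {q : Fin d → ℕ}
    (hq : Function.Injective q) :
    (Matrix.of fun k l => A k * A l * radialMoment (q k + q l)).rank = d := by
  set M : Matrix (Fin d) (Fin d) ℝ := Matrix.of fun k l => A k * A l * radialMoment (q k + q l)
    with hM
  have hunit : IsUnit M := by
    rw [← Matrix.mulVec_injective_iff_isUnit]
    refine (injective_iff_map_eq_zero (Matrix.mulVecLin M)).2 fun x hx => ?_
    have hx' : M.mulVec x = 0 := hx
    -- The quadratic form of `M` at `x` is half the integral over `[-1, 1]` of a squared combination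
    -- of powers of `√(1 - p²)`. A kernel vector forces this continuous function to vanish.
    have h1 : ∑ k, ∑ l, x k * A k * (x l * A l) * radialMoment (q k + q l) = 0 := by
      have h2 : x ⬝ᵥ M.mulVec x = 0 := by rw [hx', dotProduct_zero]
      rw [← h2, dotProduct]
      refine Finset.sum_congr rfl fun k _ => ?_
      rw [Matrix.mulVec, dotProduct, Finset.mul_sum]
      refine Finset.sum_congr rfl fun l _ => ?_
      rw [hM, Matrix.of_apply]
      ring
    have h3 : ∫ p in (-1 : ℝ)..1, (∑ k, (x k * A k) * √(1 - p ^ 2) ^ q k) ^ 2 = 0 := by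
      have h4 : ∀ p : ℝ, (∑ k, (x k * A k) * √(1 - p ^ 2) ^ q k) ^ 2
          = ∑ k, ∑ l, x k * A k * (x l * A l) * √(1 - p ^ 2) ^ (q k + q l) := by
        intro p
        rw [sq, Finset.sum_mul_sum]
        refine Finset.sum_congr rfl fun k _ => Finset.sum_congr rfl fun l _ => ?_
        rw [pow_add]
        ring
      simp only [h4]
      rw [intervalIntegral.integral_finsetSum fun k _ =>
        Continuous.intervalIntegrable (by fun_prop) _ _]
      have h5 : ∀ k, ∫ p in (-1 : ℝ)..1, ∑ l, x k * A k * (x l * A l) * √(1 - p ^ 2) ^ (q k + q l)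
          = 2 * ∑ l, x k * A k * (x l * A l) * radialMoment (q k + q l) := by
        intro k
        rw [intervalIntegral.integral_finsetSum fun l _ =>
          Continuous.intervalIntegrable (by fun_prop) _ _, Finset.mul_sum]
        refine Finset.sum_congr rfl fun l _ => ?_
        rw [intervalIntegral.integral_const_mul, radialMoment]
        ring
      simp only [h5]
      rw [← Finset.mul_sum, h1, mul_zero]
    have h6 : (fun k => x k * A k) = 0 := by
      refine sum_radial_eq_zero hq fun p hp => ?_
      by_contra hne
      refine (intervalIntegral.integral_pos
        (f := fun p => (∑ k, (x k * A k) * √(1 - p ^ 2) ^ q k) ^ 2)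
        (by norm_num : (-1 : ℝ) < 1) ?_ ?_ ⟨p, hp, sq_pos_of_ne_zero hne⟩).ne' h3
      · exact Continuous.continuousOn (by fun_prop)
      · exact fun t _ => sq_nonneg _
    funext k
    exact (mul_eq_zero.1 (congrFun h6 k)).resolve_right (hA k)
  rw [Matrix.rank_of_isUnit M hunit, Fintype.card_fin]

theorem rank_of_mul_mul {d : ℕ} (hd : 1 ≤ d) {B : Fin d → ℝ} (hB : ∀ k, B k ≠ 0) {J : ℝ}
    (hJ : J ≠ 0) : (Matrix.of fun k l => B k * B l * J).rank = 1 := by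
  have h1 : (Matrix.of fun k l => B k * B l * J) = Matrix.vecMulVec B fun l => B l * J := by
    ext k l
    simp [Matrix.vecMulVec_apply, mul_assoc]
  rw [h1]
  refine le_antisymm (Matrix.rank_vecMulVec_le _ _) (Nat.one_le_iff_ne_zero.2 fun h0 => ?_)
  rw [Matrix.rank, Submodule.finrank_eq_zero, LinearMap.range_eq_bot] at h0
  let i : Fin d := ⟨0, hd⟩
  have h2 := congrFun (LinearMap.congr_fun h0 (Pi.single i 1)) i
  simp only [Matrix.mulVecLin_apply, Matrix.mulVec_single_one, Matrix.col_apply,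
    Matrix.vecMulVec_apply, LinearMap.zero_apply, Pi.zero_apply] at h2
  exact mul_ne_zero (hB i) (mul_ne_zero (hB i) hJ) h2

theorem integral_toReal_sectionMean_mul {a b m n d : ℕ} (hd : 1 ≤ d) {r J : ℝ} (hr : 0 < r)
    (hJ0 : 0 ≤ J)
    (hJ : ∫⁻ y, sectionMean a m r y * sectionMean b n r y ∂(paramLaw d r) = ENNReal.ofReal J) :
    ∫ y, (sectionMean a m r y).toReal * (sectionMean b n r y).toReal ∂(paramLaw d r) = J := by
  have hm := (measurable_sectionMean hd a m hr).mul (measurable_sectionMean hd b n hr)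
  have h1 := integral_toReal (μ := paramLaw d r) hm.aemeasurable (ae_of_all _ fun y =>
    (mul_le_one' (sectionMean_le_one hd a m hr y) (sectionMean_le_one hd b n hr y)).trans_lt
      ENNReal.one_lt_top)
  simp only [Pi.mul_apply, ENNReal.toReal_mul] at h1
  rw [h1, hJ, ENNReal.toReal_ofReal hJ0]

end Rank

end PoissonHyperplanes

end

/-! ### Proof of the main theorem. -/

open PoissonHyperplanes in
theorem corollary4p4 {Ω : Type*} [MeasurableSpace Ω] (P : Measure Ω) [IsProbabilityMeasure P]
    (d : ℕ) (hd : 1 ≤ d) (lam : ℝ) (hlam : 0 < lam) (X : ℕ → Ω → Param d)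
    (hX : IsIsotropicPoissonHyperplaneProcess d lam X P) (ρ : ℝ) (hρ : 0 < ρ) :
    (∀ k l : Fin d,
      Tendsto (fun r : ℝ => ∫ ω, ZChi X P lam k r ω * ZChi X P lam l r ω ∂P) atTop
        (𝓝 (SigmaChi d ρ k l))) ∧
    (∀ k l : Fin d,
      Tendsto (fun r : ℝ => ∫ ω, ZNu X P lam k r ω * ZNu X P lam l r ω ∂P) atTop
        (𝓝 (SigmaNu d ρ k l))) ∧
    (SigmaChi d ρ).rank = d ∧
    (SigmaNu d ρ).rank = 1 ∧
    ∀ k l : Fin d, k < l →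
      TendstoInMeasure P
        (fun (r : ℝ) (ω : Ω) =>
          ZNu X P lam l r ω / √(SigmaNu d ρ l l) - ZNu X P lam k r ω / √(SigmaNu d ρ k k))
        atTop (fun _ => 0) := by
  have hex : ∀ (a : ℕ) (k : Fin d), ∃ A : ℝ, 0 < A ∧ ∀ r : ℝ, 0 < r → ∀ y : Param d, |y.1| < r →
      sectionMean a (d - k - 1) r y
        = ENNReal.ofReal (A * √(1 - (y.1 / r) ^ 2) ^ (a + (d - k - 1))) := fun a k =>
    exists_sectionMean_eq a (by have := k.2; omega)
  choose A hA0 hA using fun k : Fin d => hex 0 k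
  choose B hB0 hB using fun k : Fin d => hex k k
  let q : Fin d → ℕ := fun k => d - k - 1
  have hJchi : ∀ k l : Fin d, ∀ r : ℝ, 0 < r → ∫⁻ y, sectionMean 0 (d - k - 1) r y
      * sectionMean 0 (d - l - 1) r y ∂(paramLaw d r)
        = ENNReal.ofReal (A k * A l * radialMoment (q k + q l)) := by
    intro k l r hr
    rw [lintegral_sectionMean_mul hd (hA0 k) (hA0 l) (hA k) (hA l) hr]
    simp only [zero_add, q]
  have hJchi0 : ∀ k l : Fin d, 0 ≤ A k * A l * radialMoment (q k + q l) := fun k l =>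
    (mul_pos (mul_pos (hA0 k) (hA0 l)) (radialMoment_pos _)).le
  have hSchi : SigmaChi d ρ = Matrix.of fun k l => A k * A l * radialMoment (q k + q l) := by
    ext k l
    simp only [SigmaChi, Matrix.of_apply, gChi_eq _ hρ]
    exact integral_toReal_sectionMean_mul hd hρ (hJchi0 k l) (hJchi k l ρ hρ)
  -- For `ν` the exponent `k + (d - k - 1)` equals `d - 1` for every `k`, so one moment serves all
  -- entries.
  let J : ℝ := radialMoment (d - 1 + (d - 1))
  have hJpos : 0 < J := radialMoment_pos _
  have hJnu : ∀ k l : Fin d, ∀ r : ℝ, 0 < r → ∫⁻ y, sectionMean k (d - k - 1) r y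
      * sectionMean l (d - l - 1) r y ∂(paramLaw d r) = ENNReal.ofReal (B k * B l * J) := by
    intro k l r hr
    rw [lintegral_sectionMean_mul hd (hB0 k) (hB0 l) (hB k) (hB l) hr]
    have h1 : (k : ℕ) + (d - k - 1) = d - 1 := by have := k.2; omega
    have h2 : (l : ℕ) + (d - l - 1) = d - 1 := by have := l.2; omega
    rw [h1, h2]
  have hJnu0 : ∀ k l : Fin d, 0 ≤ B k * B l * J := fun k l =>
    (mul_pos (mul_pos (hB0 k) (hB0 l)) hJpos).le
  let C : Fin d → ℝ := fun k => (unitBallVol k).toReal * B k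
  have hC0 : ∀ k, 0 < C k := fun k =>
    mul_pos (ENNReal.toReal_pos (unitBallVol_ne_zero _) (unitBallVol_ne_top _)) (hB0 k)
  have hSnu : SigmaNu d ρ = Matrix.of fun k l => C k * C l * J := by
    ext k l
    simp only [SigmaNu, Matrix.of_apply]
    rw [show C k * C l * J = (unitBallVol k).toReal * (unitBallVol l).toReal * (B k * B l * J) by
        simp only [C]; ring,
      ← integral_toReal_sectionMean_mul hd hρ (hJnu0 k l) (hJnu k l ρ hρ), ← integral_const_mul]
    refine integral_congr_ae ?_
    filter_upwards [gNu_ae_eq k.2 hρ, gNu_ae_eq l.2 hρ] with y hk hl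
    rw [hk, hl]
    ring
  have hZnu : ∀ k l : Fin d, ∀ r : ℝ, 0 < r →
      (fun ω => (unitBallVol k).toReal * (unitBallVol l).toReal
        * (normSum X P lam k (d - k - 1) r ω * normSum X P lam l (d - l - 1) r ω))
      =ᵐ[P] fun ω => ZNu X P lam k r ω * ZNu X P lam l r ω := by
    intro k l r hr
    filter_upwards [ZNu_ae_eq_normSum hlam hX k.2 hr, ZNu_ae_eq_normSum hlam hX l.2 hr] with ω hk hl
    rw [hk, hl]
    ring
  have hintnu : ∀ k l : Fin d, ∀ᶠ r in atTop,
      Integrable (fun ω => ZNu X P lam k r ω * ZNu X P lam l r ω) P := by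
    intro k l
    filter_upwards [eventually_gt_atTop 0, (tendsto_integral_normSum_mul hd hlam hX k l (d - k - 1)
      (d - l - 1) (hJnu0 k l) (hJnu k l)).1] with r hr hi
    exact (hi.const_mul _).congr (hZnu k l r hr)
  have hlimnu : ∀ k l : Fin d,
      Tendsto (fun r : ℝ => ∫ ω, ZNu X P lam k r ω * ZNu X P lam l r ω ∂P) atTop
        (𝓝 (C k * C l * J)) := by
    intro k l
    have h1 := ((tendsto_integral_normSum_mul hd hlam hX k l (d - k - 1)
      (d - l - 1) (hJnu0 k l) (hJnu k l)).2).const_mul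
        ((unitBallVol k).toReal * (unitBallVol l).toReal)
    rw [show C k * C l * J = (unitBallVol k).toReal * (unitBallVol l).toReal * (B k * B l * J) by
        simp only [C]; ring]
    refine h1.congr' ?_
    filter_upwards [eventually_gt_atTop 0] with r hr
    rw [← integral_const_mul]
    exact integral_congr_ae (hZnu k l r hr)
  refine ⟨fun k l => ?_, fun k l => ?_, ?_, ?_, fun k l _ => ?_⟩
  · rw [hSchi]
    refine ((tendsto_integral_normSum_mul hd hlam hX 0 0 (d - k - 1) (d - l - 1) (hJchi0 k l)
      (hJchi k l)).2).congr' ?_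
    filter_upwards [eventually_gt_atTop 0] with r hr
    simp only [ZChi_eq_normSum k.2 hr, ZChi_eq_normSum l.2 hr]
  · rw [hSnu]
    exact hlimnu k l
  · rw [hSchi]
    -- For `χ` the exponents `d - k - 1` are pairwise distinct.
    refine rank_radialMoment (fun k => (hA0 k).ne') fun k l hkl => Fin.ext ?_
    have hk := k.2
    have hl := l.2
    simp only [q] at hkl
    omega
  · rw [hSnu]
    exact rank_of_mul_mul hd (fun k => (hC0 k).ne') hJpos.ne'
  -- The limiting second moments `C k * C l * J` are products of these standard deviations, that is,
  -- asymptotic correlation one.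
  · have hsq : ∀ k : Fin d, √(SigmaNu d ρ k k) = C k * √J := by
      intro k
      rw [hSnu, Matrix.of_apply, Real.sqrt_mul (mul_self_nonneg _), Real.sqrt_mul_self (hC0 k).le]
    have hmul : ∀ k l : Fin d, C k * √J * (C l * √J) = C k * C l * J := by
      intro k l
      rw [mul_mul_mul_comm, Real.mul_self_sqrt hJpos.le]
    have hpos : ∀ k : Fin d, C k * √J ≠ 0 := fun k =>
      (mul_pos (hC0 k) (Real.sqrt_pos.2 hJpos)).ne'
    rw [hsq, hsq]
    refine tendstoInMeasure_div_sub_div (hpos l) (hpos k) (hintnu l l) (hintnu l k) (hintnu k k)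
      ?_ ?_ ?_
    · rw [hmul]
      exact hlimnu l l
    · rw [hmul]
      exact hlimnu l k
    · rw [hmul]
      exact hlimnu k k
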